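/- Let $n\ge 3$ be an integer and let $p,q$ be real numbers with $1<p<\frac{n+2}{n-2}<q$. For a function $f$ and $R>0$, a singular solution on $(0,R)$ of $$u''+\frac{n-1}{r}u'+f(u)=0$$ means a positive function $u\in C^2(0,R)$ satisfying the equation on $(0,R)$ with $\lim_{r\to 0^+}u(r)=\infty$. Put $$B=\frac{2}{(q-1)^2}\bigl[-2+(q-1)(n-2)\bigr],\qquad w_0(r)=B^{\frac1{q-1}}\,r^{-\frac{2}{q-1}}\quad(r>0).$$ Then: 1. The equation $u''+\frac{n-1}{r}u'+u^p+u^q=0$ has a singular solution $W_0$ on some interval $(0,R)$, and it is unique: any two singular solutions, on $(0,R_1)$ and $(0,R_2)$, coincide on $(0,\min(R_1,R_2))$. 2. The function $w_0$ is the unique singular solution of $u''+\frac{n-1}{r}u'+u^q=0$: it is a singular solution on every $(0,R)$, and every singular solution on an interval $(0,R)$ coincides with $w_0$ there. 3. For the singular solution $W_0$ of the equation in 1 (on any $(0,R)$), $$\lim_{r\to 0^+}\frac{W_0(r)}{w_0(r)}=1.$$ -/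

import Mathlib

open Set Filter Topology

/-- `u` is a (positive, classical) singular solution on `(0, R)` of the radial equation
`u'' + ((n - 1) / r) u' + f(u) = 0`: a positive `C²` function on `(0, R)` satisfying the equation
there, with `u(r) → ∞` as `r → 0⁺`. -/
structure IsSingularSolution (n : ℕ) (f : ℝ → ℝ) (R : ℝ) (u : ℝ → ℝ) : Prop where
  radius_pos : 0 < R
  pos : ∀ r ∈ Ioo 0 R, 0 < u r
  contDiffOn : ContDiffOn ℝ 2 u (Ioo 0 R)
  equation : ∀ r ∈ Ioo 0 R,
    deriv (deriv u) r + ((n : ℝ) - 1) / r * deriv u r + f (u r) = 0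
  singular : Tendsto u (𝓝[>] 0) atTop

/-- The constant `B = 2 / (q - 1)² · (-2 + (q - 1)(n - 2))`. -/
noncomputable def laneEmdenB (n : ℕ) (q : ℝ) : ℝ :=
  2 / (q - 1) ^ 2 * (-2 + (q - 1) * ((n : ℝ) - 2))

/-- The function `w₀(r) = B^{1/(q-1)} r^{-2/(q-1)}`. -/
noncomputable def laneEmdenSingular (n : ℕ) (q : ℝ) (r : ℝ) : ℝ :=
  laneEmdenB n q ^ (1 / (q - 1)) * r ^ (-2 / (q - 1))

/-! Put r = e^t, v(t) = e^{θt} u(e^t) with θ = 2/(q-1), β = n-2-θ. The equation u'' + (n-1)/r u' +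
σu^p + u^q = 0 becomes v'' + (β-θ) v' - θβ v + v^q + σ e^{θ(q-p)t} v^p = 0, where σ = 1 gives the
two-power equation and σ = 0 the pure power. The singularity r = 0 sits at t = -∞, where the p-term
fades because p < q. Supercriticality of q is exactly β - θ > 0, so the equation is damped. The
function w₀ is the constant equilibrium x₀ = (θβ)^{1/(q-1)}, and θβ = B.

Asymptotics: monotonicity of u and one integration bound v and v' (`exists_bound`,
`exists_deriv_bound`). The energy then has a limit at -∞, and Barbalat's lemma gives v' → 0 and θβ v
- v^q → 0, so v tends to 0 or to x₀. The limit 0 would force u to be bounded (`not_tendsto_zero`).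
Hence v → x₀, which is the claim W₀/w₀ → 1.

Uniqueness: at x₀ the linearisation d'' + (β-θ)d' + (q-1)θβ d = 0 is stable as t increases. The
difference of two solutions tends to 0 at -∞ while a positive definite Lyapunov function of it does
not increase, so the difference vanishes near -∞ (`eqOn_near_atBot`). A Gronwall estimate carries
the equality forward.

Existence: the same stability makes the linear operator invertible on bounded functions on the whole
line, with a loss controlled by the real parts of its roots. After truncation the nonlinear part is
a small Lipschitz perturbation, and a contraction argument finds v near x₀
(`exists_bounded_solution`). -/

/-! ### Monotonicity and limits at `-∞`. -/

theorem monotoneOn_Iio_of_hasDerivAt_nonneg {φ φ' : ℝ → ℝ} {T : ℝ}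
    (hφ : ∀ t < T, HasDerivAt φ (φ' t) t) (hφ' : ∀ t < T, 0 ≤ φ' t) :
    MonotoneOn φ (Iio T) := by
  apply monotoneOn_of_deriv_nonneg (convex_Iio T)
  · exact fun x hx => (hφ x hx).continuousAt.continuousWithinAt
  · rw [interior_Iio]
    exact fun x hx => (hφ x hx).differentiableAt.differentiableWithinAt
  · rw [interior_Iio]
    intro x hx
    rw [(hφ x hx).deriv]
    exact hφ' x hx

/-- A function with nonnegative derivative that is bounded below near `-∞` by a function tending
to zero is nonnegative. -/
theorem nonneg_of_hasDerivAt_nonneg_atBot {φ φ' ψ : ℝ → ℝ} {T : ℝ}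
    (hφ : ∀ t < T, HasDerivAt φ (φ' t) t) (hφ' : ∀ t < T, 0 ≤ φ' t)
    (hψ : Tendsto ψ atBot (𝓝 0)) (hle : ∀ᶠ s in atBot, ψ s ≤ φ s) :
    ∀ t < T, 0 ≤ φ t := by
  intro t ht
  have hmono := monotoneOn_Iio_of_hasDerivAt_nonneg hφ hφ'
  refine le_of_tendsto hψ ?_
  filter_upwards [hle, eventually_le_atBot t] with s hs hst
  exact hs.trans (hmono (lt_of_le_of_lt hst ht) ht hst)

theorem tendsto_exp_mul_atBot {a : ℝ} (ha : 0 < a) :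
    Tendsto (fun t : ℝ => Real.exp (a * t)) atBot (𝓝 0) :=
  Real.tendsto_exp_atBot.comp (tendsto_id.const_mul_atBot ha)

theorem hasDerivAt_exp_const_mul (a t : ℝ) :
    HasDerivAt (fun s : ℝ => Real.exp (a * s)) (a * Real.exp (a * t)) t := by
  have := ((hasDerivAt_id t).const_mul a).exp
  simpa [mul_comm] using this

/-- Barbalat's lemma at `-∞`. -/
theorem tendsto_zero_of_tendsto_of_hasDerivAt {F g g' e : ℝ → ℝ} {T K l : ℝ}
    (hF : ∀ t < T, HasDerivAt F (g t + e t) t) (hFl : Tendsto F atBot (𝓝 l))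
    (he : Tendsto e atBot (𝓝 0)) (hg : ∀ t < T, HasDerivAt g (g' t) t)
    (hg' : ∀ t < T, |g' t| ≤ K) : Tendsto g atBot (𝓝 0) := by
  have hK : 0 ≤ K := (abs_nonneg _).trans (hg' (T - 1) (by linarith))
  rw [Metric.tendsto_nhds]
  intro ε hε
  -- On a window of length τ the function g varies by at most Kτ ≤ ε/3, while g + e takes there its
  -- mean value (F t - F (t - τ))/τ, which tends to 0.
  set τ := ε / (3 * (K + 1)) with hτ
  have hτ0 : 0 < τ := by positivity
  have hKτ : K * τ ≤ ε / 3 := by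
    rw [hτ, mul_div_assoc', div_le_div_iff₀ (by positivity) (by positivity)]
    nlinarith
  have hdiff : Tendsto (fun t => F t - F (t - τ)) atBot (𝓝 0) := by
    have h1 : Tendsto (fun t : ℝ => t - τ) atBot atBot :=
      tendsto_atBot_add_const_right _ (-τ) tendsto_id
    simpa using hFl.sub (hFl.comp h1)
  obtain ⟨N, hN⟩ := eventually_atBot.1 ((Metric.tendsto_nhds.1 he (ε / 3) (by positivity)).and
    (Metric.tendsto_nhds.1 hdiff (τ * (ε / 3)) (by positivity)))
  filter_upwards [eventually_le_atBot N, eventually_lt_atBot T] with t htN htT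
  obtain ⟨ξ, hξ, hFξ⟩ := exists_hasDerivAt_eq_slope F (fun s => g s + e s)
    (show t - τ < t by linarith)
    (fun s hs => (hF s (by linarith [hs.2])).continuousAt.continuousWithinAt)
    (fun s hs => hF s (by linarith [hs.2]))
  obtain ⟨η, hη, hgη⟩ := exists_hasDerivAt_eq_slope g g' hξ.2
    (fun s hs => (hg s (by linarith [hs.2])).continuousAt.continuousWithinAt)
    (fun s hs => hg s (by linarith [hs.2]))
  have h1 := (hN ξ (by linarith [hξ.2])).1
  have h2 := (hN t htN).2
  simp only [Real.dist_eq, sub_zero] at h1 h2 ⊢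
  have hξt : 0 < t - ξ := by linarith [hξ.2]
  have h3 : |g t - g ξ| ≤ K * τ := by
    rw [eq_div_iff hξt.ne'] at hgη
    rw [← hgη, abs_mul, abs_of_pos hξt]
    exact mul_le_mul (hg' η (by linarith [hη.2])) (by linarith [hξ.1]) hξt.le hK
  have h4 : |g ξ + e ξ| < ε / 3 := by
    rw [hFξ, abs_div, show t - (t - τ) = τ by ring, abs_of_pos hτ0, div_lt_iff₀ hτ0]
    linarith
  rw [abs_lt] at h1 h4 ⊢
  rw [abs_le] at h3
  constructor <;> linarith

/-- A bounded function on a left half-line cannot have derivative at most `-1` near `-∞`. -/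
theorem false_of_bounded_of_hasDerivAt_le {v w : ℝ → ℝ} {M : ℝ} {T : ℝ}
    (hv : ∀ t < T, HasDerivAt v (w t) t) (hM : ∀ t < T, |v t| ≤ M)
    (hw : ∀ᶠ t in atBot, w t ≤ -1) : False := by
  obtain ⟨N, hN⟩ := eventually_atBot.1 (hw.and (eventually_lt_atBot T))
  have hM0 : 0 ≤ M := (abs_nonneg _).trans (hM N (hN N le_rfl).2)
  obtain ⟨ξ, hξ, hs⟩ := exists_hasDerivAt_eq_slope v w
    (show N - (2 * M + 1) < N by linarith)
    (fun s hs => (hv s (hN s hs.2).2).continuousAt.continuousWithinAt)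
    (fun s hs => hv s (hN s hs.2.le).2)
  have h1 := (hN ξ hξ.2.le).1
  rw [hs, div_le_iff₀ (by linarith)] at h1
  have h2 := abs_le.1 (hM N (hN N le_rfl).2)
  have h3 := abs_le.1 (hM _ (hN (N - (2 * M + 1)) (by linarith)).2)
  linarith

/-! ### The Emden-Fowler equation and a priori bounds. -/

/-- The exponents `1 < p < q` and the constants `θ = 2 / (q - 1)`, `β = n - 2 - θ`, `σ ≥ 0` of the
equation `u'' + (n - 1) / r u' + σ u ^ p + u ^ q = 0` with supercritical `q`. -/
structure IsSupercritical (θ β σ p q : ℝ) : Prop where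
  theta_pos : 0 < θ
  theta_lt : θ < β
  sigma_nonneg : 0 ≤ σ
  one_lt : 1 < p
  lt : p < q
  scaling : θ * (q - 1) = 2

/-- The nonlinearity in the Emden-Fowler variables. -/
noncomputable def emdenFowlerTerm (θ σ p q t x : ℝ) : ℝ :=
  x ^ q + σ * Real.exp (θ * (q - p) * t) * x ^ p

/-- `v` and its derivative `w` form a positive solution of the Emden-Fowler equation on
`(-∞, T)` that corresponds to a singular solution of the radial equation. -/
structure IsEmdenFowlerSolution (θ β σ p q T : ℝ) (v w : ℝ → ℝ) : Prop where
  pos : ∀ t < T, 0 < v t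
  hasDerivAt_fst : ∀ t < T, HasDerivAt v (w t) t
  hasDerivAt_snd : ∀ t < T, HasDerivAt w
    (θ * β * v t - (β - θ) * w t - emdenFowlerTerm θ σ p q t (v t)) t
  singular : Tendsto (fun t => Real.exp (-θ * t) * v t) atBot atTop

namespace IsEmdenFowlerSolution

variable {θ β σ p q T : ℝ} {v w : ℝ → ℝ}

theorem mono {T' : ℝ} (h : IsEmdenFowlerSolution θ β σ p q T v w) (hT : T' ≤ T) :
    IsEmdenFowlerSolution θ β σ p q T' v w where
  pos t ht := h.pos t (ht.trans_le hT)
  hasDerivAt_fst t ht := h.hasDerivAt_fst t (ht.trans_le hT)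
  hasDerivAt_snd t ht := h.hasDerivAt_snd t (ht.trans_le hT)
  singular := h.singular

theorem term_ge (hs : IsSupercritical θ β σ p q) (h : IsEmdenFowlerSolution θ β σ p q T v w)
    {t : ℝ} (ht : t < T) : v t ^ q ≤ emdenFowlerTerm θ σ p q t (v t) := by
  have := hs.sigma_nonneg
  have := h.pos t ht
  unfold emdenFowlerTerm
  have : 0 ≤ σ * Real.exp (θ * (q - p) * t) * v t ^ p := by positivity
  linarith

theorem term_pos (hs : IsSupercritical θ β σ p q) (h : IsEmdenFowlerSolution θ β σ p q T v w)
    {t : ℝ} (ht : t < T) : 0 < emdenFowlerTerm θ σ p q t (v t) :=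
  (Real.rpow_pos_of_pos (h.pos t ht) q).trans_le (h.term_ge hs ht)

/-- The derivative of `e^{bt} (v' - θ v)`. -/
theorem hasDerivAt_flux (h : IsEmdenFowlerSolution θ β σ p q T v w) (b : ℝ) {t : ℝ} (ht : t < T) :
    HasDerivAt (fun s => Real.exp (b * s) * (w s - θ * v s))
      (Real.exp (b * t) * ((b - β) * (w t - θ * v t) - emdenFowlerTerm θ σ p q t (v t))) t := by
  have := (hasDerivAt_exp_const_mul b t).mul
    ((h.hasDerivAt_snd t ht).sub ((h.hasDerivAt_fst t ht).const_mul θ))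
  refine this.congr_deriv ?_
  simp only [Pi.sub_apply]
  ring

theorem hasDerivAt_scaled (h : IsEmdenFowlerSolution θ β σ p q T v w) (b : ℝ) {t : ℝ}
    (ht : t < T) : HasDerivAt (fun s => Real.exp (b * s) * v s)
      (Real.exp (b * t) * (w t + b * v t)) t := by
  refine ((hasDerivAt_exp_const_mul b t).mul (h.hasDerivAt_fst t ht)).congr_deriv ?_
  ring

/-- A singular solution is strictly decreasing in the radial variable. -/
theorem flux_neg (hs : IsSupercritical θ β σ p q) (h : IsEmdenFowlerSolution θ β σ p q T v w)
    {t : ℝ} (ht : t < T) : w t - θ * v t < 0 := by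
  by_contra! hcon
  -- With β = n-2-θ this function is r^{n-1} u' at r = e^s. If it is nonnegative at t, it is so at
  -- all smaller radii, where u would be nondecreasing in r, against u → ∞ at 0.
  have hanti : AntitoneOn (fun s => Real.exp (β * s) * (w s - θ * v s)) (Iio T) := by
    have := monotoneOn_Iio_of_hasDerivAt_nonneg (T := T)
      (fun s hs => (h.hasDerivAt_flux β hs).neg) (fun s hst => by
        have := h.term_pos hs hst
        have := Real.exp_pos (β * s)
        simp only [sub_self, zero_mul, zero_sub, mul_neg, neg_neg]
        positivity)
    intro a ha b hb hab
    have := this ha hb hab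
    simpa using this
  have hpos : ∀ s < t, 0 ≤ w s - θ * v s := fun s hst => by
    have h1 := hanti (hst.trans ht) ht hst.le
    have h2 : 0 ≤ Real.exp (β * t) * (w t - θ * v t) := mul_nonneg (Real.exp_pos _).le hcon
    exact nonneg_of_mul_nonneg_right (h2.trans h1) (Real.exp_pos _)
  have hmono := monotoneOn_Iio_of_hasDerivAt_nonneg (T := t)
    (fun s hs => h.hasDerivAt_scaled (-θ) (hs.trans ht)) (fun s hst => by
      have := hpos s hst
      exact mul_nonneg (Real.exp_pos _).le (by linarith))
  have hsing := h.singular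
  obtain ⟨N, hN⟩ := eventually_atBot.1
    (hsing.eventually_gt_atTop (Real.exp (-θ * (t - 1)) * v (t - 1)))
  have h1 := hN (min N (t - 1)) (min_le_left _ _)
  have h2 := hmono (show min N (t - 1) < t from (min_le_right _ _).trans_lt (by linarith))
    (show t - 1 < t by linarith) (min_le_right _ _)
  exact absurd h1 (not_lt.2 h2)

/-- In radial terms, -r^{n-1}u' ≥ ∫₀^r s^{n-1}u^q ds ≥ u(r)^q r^n/n, since u decreases and
-r^{n-1}u' ≥ 0 near 0. The number β + θq = β + θ + 2 plays the role of n. -/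
theorem flux_le (hs : IsSupercritical θ β σ p q) (h : IsEmdenFowlerSolution θ β σ p q T v w)
    {t : ℝ} (ht : t < T) : v t ^ q / (β + θ * q) ≤ -(w t - θ * v t) := by
  have hθ := hs.theta_pos
  have hβ : 0 < β := hθ.trans hs.theta_lt
  have hq : 0 < q := by linarith [hs.one_lt, hs.lt]
  have hb : 0 < β + θ * q := by positivity
  have hUanti : ∀ s ≤ t, Real.exp (-θ * t) * v t ≤ Real.exp (-θ * s) * v s := fun s hst => by
    have := monotoneOn_Iio_of_hasDerivAt_nonneg (T := T)
      (fun s hs => (h.hasDerivAt_scaled (-θ) hs).neg) (fun s hsT => by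
        have := h.flux_neg hs hsT
        rw [← mul_neg]
        exact mul_nonneg (Real.exp_pos _).le (by linarith))
    simpa using this (hst.trans_lt ht) ht hst
  set U := Real.exp (-θ * t) * v t with hU
  have hU0 : 0 < U := mul_pos (Real.exp_pos _) (h.pos t ht)
  have key : ∀ s ≤ t, Real.exp ((β + θ * q) * s) * U ^ q ≤ Real.exp (β * s) * v s ^ q := by
    intro s hst
    have hvs := h.pos s (hst.trans_lt ht)
    have h1 : U ^ q ≤ (Real.exp (-θ * s) * v s) ^ q :=
      Real.rpow_le_rpow hU0.le (hUanti s hst) hq.le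
    rw [Real.mul_rpow (Real.exp_pos _).le hvs.le, ← Real.exp_mul] at h1
    calc _ ≤ Real.exp ((β + θ * q) * s) * (Real.exp (-θ * s * q) * v s ^ q) := by gcongr
      _ = _ := by
        rw [← mul_assoc, ← Real.exp_add]
        ring_nf
  have hcont : ∀ s ≤ t, HasDerivAt
      (fun s => -(Real.exp (β * s) * (w s - θ * v s)) -
        U ^ q / (β + θ * q) * Real.exp ((β + θ * q) * s))
      (-(Real.exp (β * s) * ((β - β) * (w s - θ * v s) - emdenFowlerTerm θ σ p q s (v s))) -
        U ^ q / (β + θ * q) * ((β + θ * q) * Real.exp ((β + θ * q) * s))) s := fun s hst =>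
    (h.hasDerivAt_flux β (hst.trans_lt ht)).neg.sub
      ((hasDerivAt_exp_const_mul (β + θ * q) s).const_mul _)
  have hnn : ∀ s < t, 0 ≤ -(Real.exp (β * s) * (w s - θ * v s)) -
        U ^ q / (β + θ * q) * Real.exp ((β + θ * q) * s) := by
    refine nonneg_of_hasDerivAt_nonneg_atBot (fun s hst => hcont s hst.le) (fun s hst => ?_)
      (ψ := fun s => - (U ^ q / (β + θ * q)) * Real.exp ((β + θ * q) * s))
      (by simpa using (tendsto_exp_mul_atBot hb).const_mul (- (U ^ q / (β + θ * q)))) ?_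
    · have h1 := key s hst.le
      have h2 := mul_le_mul_of_nonneg_left (h.term_ge hs (hst.trans ht)) (Real.exp_pos (β * s)).le
      have h3 : U ^ q / (β + θ * q) * ((β + θ * q) * Real.exp ((β + θ * q) * s))
        = Real.exp ((β + θ * q) * s) * U ^ q := by field_simp
      rw [h3]
      linarith
    · filter_upwards [eventually_lt_atBot t] with s hst
      have := mul_neg_of_pos_of_neg (Real.exp_pos (β * s)) (h.flux_neg hs (hst.trans ht))
      linarith
  -- The comparison lives on the open half-line s < t, because U is frozen at t; continuity gives
  -- the endpoint.
  have hfin := ContinuousWithinAt.closure_le (s := Iio t) (x := t) (by simp)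
    continuousWithinAt_const (hcont t le_rfl).continuousAt.continuousWithinAt hnn
  have h3 : Real.exp ((β + θ * q) * t) * U ^ q = Real.exp (β * t) * v t ^ q := by
    rw [hU, Real.mul_rpow (Real.exp_pos _).le (h.pos t ht).le, ← Real.exp_mul, ← mul_assoc,
      ← Real.exp_add]
    ring_nf
  have h4 : U ^ q / (β + θ * q) * Real.exp ((β + θ * q) * t) =
      Real.exp (β * t) * (v t ^ q / (β + θ * q)) := by
    rw [div_mul_eq_mul_div, mul_comm, h3, mul_div_assoc]
  rw [h4] at hfin
  have h5 : Real.exp (β * t) * (v t ^ q / (β + θ * q)) ≤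
      Real.exp (β * t) * -(w t - θ * v t) := by linarith
  exact le_of_mul_le_mul_left h5 (Real.exp_pos _)

/-- Dividing the flux bound by u^q and integrating from 0 gives u^{1-q} ≥ (q-1)r²/(2n). Since
e^{2t}v^{1-q} = u^{1-q}, this reads v^{1-q} ≥ k. -/
theorem exists_bound (hs : IsSupercritical θ β σ p q)
    (h : IsEmdenFowlerSolution θ β σ p q T v w) : ∃ M, ∀ t < T, v t ≤ M := by
  have hθ := hs.theta_pos
  have hβ : 0 < β := hθ.trans hs.theta_lt
  have hq1 : 0 < q - 1 := by linarith [hs.one_lt, hs.lt]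
  have hb : 0 < β + θ * q := by nlinarith
  set k := (q - 1) / (2 * (β + θ * q)) with hk
  have hk0 : 0 < k := by positivity
  have hd : ∀ t < T, HasDerivAt (fun s => Real.exp (2 * s) * (v s ^ (1 - q) - k))
      (Real.exp (2 * t) * (2 * (v t ^ (1 - q) - k) + w t * (1 - q) * v t ^ (1 - q - 1))) t := by
    intro t ht
    refine ((hasDerivAt_exp_const_mul 2 t).mul
      (((h.hasDerivAt_fst t ht).rpow_const (p := 1 - q) (Or.inl (h.pos t ht).ne')).sub_const
        k)).congr_deriv ?_
    ring
  have hnn := nonneg_of_hasDerivAt_nonneg_atBot hd (fun t ht => by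
      refine mul_nonneg (Real.exp_pos _).le ?_
      have hv := h.pos t ht
      have h1 := h.flux_le hs ht
      have e1 : v t ^ (1 - q) = v t * v t ^ (1 - q - 1) := by
        rw [Real.rpow_sub_one hv.ne', mul_div_cancel₀ _ hv.ne']
      have e2 : v t ^ q * v t ^ (1 - q - 1) = 1 := by
        rw [← Real.rpow_add hv]
        simp
      have h2 := mul_le_mul_of_nonneg_right h1
        (mul_nonneg hq1.le (Real.rpow_pos_of_pos hv (1 - q - 1)).le)
      have e3 : v t ^ q / (β + θ * q) * ((q - 1) * v t ^ (1 - q - 1)) = 2 * k := by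
        rw [hk]
        have : v t ^ q / (β + θ * q) * ((q - 1) * v t ^ (1 - q - 1)) =
          (v t ^ q * v t ^ (1 - q - 1)) * (q - 1) / (β + θ * q) := by ring
        rw [this, e2]
        field_simp
      rw [e3] at h2
      rw [e1]
      have e4 := hs.scaling
      have e5 : θ * v t * ((q - 1) * v t ^ (1 - q - 1)) = 2 * (v t * v t ^ (1 - q - 1)) := by
        rw [← e4]; ring
      linarith)
    (ψ := fun s => -k * Real.exp (2 * s))
    (by simpa using (tendsto_exp_mul_atBot (a := 2) (by norm_num)).const_mul (-k)) (by
      filter_upwards [eventually_lt_atBot T] with t ht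
      have := Real.rpow_pos_of_pos (h.pos t ht) (1 - q)
      have := mul_pos (Real.exp_pos (2 * t)) this
      linarith)
  refine ⟨k ^ (1 / (1 - q)), fun t ht => ?_⟩
  have h1 := nonneg_of_mul_nonneg_right (hnn t ht) (Real.exp_pos _)
  have hv := h.pos t ht
  have h2 : k ≤ v t ^ (1 - q) := by linarith
  have h3 := Real.rpow_le_rpow_of_nonpos hk0 h2 (z := 1 / (1 - q))
    (by rw [one_div]; exact inv_nonpos.2 (by linarith))
  rwa [← Real.rpow_mul hv.le, mul_one_div_cancel (by linarith), Real.rpow_one] at h3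

theorem term_bound (hs : IsSupercritical θ β σ p q)
    (h : IsEmdenFowlerSolution θ β σ p q T v w) (hT : T ≤ 0) :
    ∃ H, ∀ t < T, emdenFowlerTerm θ σ p q t (v t) ≤ H := by
  obtain ⟨M, hM⟩ := h.exists_bound hs
  have := hs.one_lt
  have := hs.lt
  have := hs.sigma_nonneg
  have hp0 : 0 ≤ p := by linarith
  have hq0 : 0 ≤ q := by linarith
  refine ⟨M ^ q + σ * 1 * M ^ p, fun t ht => ?_⟩
  have hv := h.pos t ht
  have hvM := hM t ht
  have h1 : Real.exp (θ * (q - p) * t) ≤ 1 := by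
    rw [Real.exp_le_one_iff]
    exact mul_nonpos_of_nonneg_of_nonpos (mul_nonneg hs.theta_pos.le (by linarith)) (by linarith)
  unfold emdenFowlerTerm
  gcongr

/-- If w - θv were below -H/β at some time, damping at rate β, run backwards, would drive it to -∞
exponentially, and v could not stay bounded. -/
theorem exists_deriv_bound (hs : IsSupercritical θ β σ p q)
    (h : IsEmdenFowlerSolution θ β σ p q T v w) (hT : T ≤ 0) : ∃ N, ∀ t < T, |w t| ≤ N := by
  obtain ⟨M, hM⟩ := h.exists_bound hs
  obtain ⟨H, hH⟩ := h.term_bound hs hT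
  have hθ := hs.theta_pos
  have hβ : 0 < β := hθ.trans hs.theta_lt
  have key : ∀ t < T, -(H / β) ≤ w t - θ * v t := by
    intro t ht
    by_contra! hcon
    have hmono := monotoneOn_Iio_of_hasDerivAt_nonneg (T := T)
      (fun s hs => (h.hasDerivAt_flux β hs).add
        ((hasDerivAt_exp_const_mul β s).const_mul (H / β))) (fun s hst => by
        have h1 := hH s hst
        have h2 : H / β * (β * Real.exp (β * s)) = Real.exp (β * s) * H := by field_simp
        rw [h2]
        have := mul_le_mul_of_nonneg_left h1 (Real.exp_pos (β * s)).le
        linarith)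
    set c := -(Real.exp (β * t) * (w t - θ * v t + H / β)) with hc
    have hc0 : 0 < c := by
      rw [hc]
      have := mul_neg_of_pos_of_neg (Real.exp_pos (β * t))
        (show w t - θ * v t + H / β < 0 by linarith)
      linarith
    have hle : ∀ s < t, w s - θ * v s + H / β ≤ -c * Real.exp (-β * s) := by
      intro s hst
      have h1 := hmono (hst.trans ht) ht hst.le
      simp only [Pi.add_apply] at h1
      have h2 : Real.exp (β * s) * (w s - θ * v s + H / β) ≤ -c := by
        rw [hc]; linarith
      have h3 := mul_le_mul_of_nonneg_right h2 (Real.exp_pos (-β * s)).le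
      have h4 : Real.exp (β * s) * Real.exp (-β * s) = 1 := by
        rw [← Real.exp_add]; simp
      calc _ = Real.exp (β * s) * (w s - θ * v s + H / β) * Real.exp (-β * s) := by
            rw [mul_right_comm, h4, one_mul]
        _ ≤ _ := h3
    have hlim : Tendsto (fun s => c * Real.exp (-β * s)) atBot atTop := by
      refine Tendsto.const_mul_atTop hc0 (Real.tendsto_exp_atTop.comp ?_)
      exact tendsto_id.const_mul_atBot_of_neg (by linarith)
    refine false_of_bounded_of_hasDerivAt_le (M := M) (T := T) h.hasDerivAt_fst
      (fun s hs => by rw [abs_of_pos (h.pos s hs)]; exact hM s hs) ?_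
    filter_upwards [hlim.eventually_ge_atTop (1 + θ * M - H / β), eventually_lt_atBot t]
      with s h1 h2
    have h3 := hle s h2
    have h4 := mul_le_mul_of_nonneg_left (hM s (h2.trans ht)) hθ.le
    linarith
  refine ⟨|H / β| + θ * M, fun t ht => ?_⟩
  have h1 := key t ht
  have h2 := h.flux_neg hs ht
  have h3 := mul_le_mul_of_nonneg_left (hM t ht) hθ.le
  have h4 := mul_pos hθ (h.pos t ht)
  have h5 := neg_abs_le (H / β)
  have h6 := le_abs_self (H / β)
  rw [abs_le]
  constructor <;> linarith

end IsEmdenFowlerSolution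

/-! ### Convergence to the equilibrium at `-∞`. -/

theorem exists_tendsto_atBot_of_monotoneOn_Iio {F : ℝ → ℝ} {T m : ℝ} (hF : MonotoneOn F (Iio T))
    (hm : ∀ t < T, m ≤ F t) : ∃ l, Tendsto F atBot (𝓝 l) := by
  have hlt : ∀ t, min t (T - 1) < T := fun t => (min_le_right _ _).trans_lt (by linarith)
  have hmono : Monotone fun t => F (min t (T - 1)) := fun a b hab =>
    hF (hlt a) (hlt b) (min_le_min_right _ hab)
  refine ⟨_, (tendsto_atBot_ciInf hmono ⟨m, ?_⟩).congr' ?_⟩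
  · rintro _ ⟨t, rfl⟩
    exact hm _ (hlt t)
  · filter_upwards [eventually_le_atBot (T - 1)] with t ht
    rw [min_eq_left ht]

theorem tendsto_exp_mul_bounded_atBot {a C T : ℝ} (ha : 0 < a) {f : ℝ → ℝ}
    (hf : ∀ t < T, |f t| ≤ C) : Tendsto (fun t => Real.exp (a * t) * f t) atBot (𝓝 0) := by
  refine squeeze_zero_norm' (a := fun t => Real.exp (a * t) * C) ?_
    (by simpa using (tendsto_exp_mul_atBot ha).mul_const C)
  filter_upwards [eventually_lt_atBot T] with t ht
  rw [Real.norm_eq_abs, abs_mul, abs_of_pos (Real.exp_pos _)]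
  exact mul_le_mul_of_nonneg_left (hf t ht) (Real.exp_pos _).le

namespace IsEmdenFowlerSolution

variable {θ β σ p q T : ℝ} {v w : ℝ → ℝ}

/-- The energy E dissipates at rate (β-θ)w² up to an error of order e^{θ(q-p)t}. It is bounded,
hence has a limit, and Barbalat's lemma applied to E gives w² → 0. -/
theorem tendsto_deriv (hs : IsSupercritical θ β σ p q)
    (h : IsEmdenFowlerSolution θ β σ p q T v w) (hT : T ≤ 0) : Tendsto w atBot (𝓝 0) := by
  obtain ⟨M, hM⟩ := h.exists_bound hs
  obtain ⟨H, hH⟩ := h.term_bound hs hT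
  obtain ⟨N, hN⟩ := h.exists_deriv_bound hs hT
  have hθ := hs.theta_pos
  have hβ : 0 < β := hθ.trans hs.theta_lt
  have hp := hs.one_lt
  have hpq := hs.lt
  have hσ := hs.sigma_nonneg
  have hα : 0 < β - θ := by linarith [hs.theta_lt]
  have hδ : 0 < θ * (q - p) := mul_pos hθ (by linarith)
  have hM0 : 0 ≤ M := (h.pos (T - 1) (by linarith)).le.trans (hM _ (by linarith))
  have hN0 : 0 ≤ N := (abs_nonneg _).trans (hN (T - 1) (by linarith))
  have hp0 : 0 ≤ p := by linarith
  have hq0 : 0 ≤ q := by linarith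
  have hC : ∀ t < T, |σ * v t ^ p * w t| ≤ σ * M ^ p * N := fun t ht => by
    have hv := h.pos t ht
    rw [abs_mul, abs_of_nonneg (by positivity : 0 ≤ σ * v t ^ p)]
    gcongr
    · exact hM t ht
    · exact hN t ht
  set C := σ * M ^ p * N with hCdef
  set E := fun t => w t ^ 2 / 2 - θ * β * (v t ^ 2 / 2) + v t ^ (q + 1) / (q + 1) with hE
  have hEd : ∀ t < T, HasDerivAt E
      (-(β - θ) * w t ^ 2 + -(Real.exp (θ * (q - p) * t) * (σ * v t ^ p * w t))) t := by
    intro t ht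
    have h1 := ((((h.hasDerivAt_snd t ht).pow 2).div_const 2).sub
      ((((h.hasDerivAt_fst t ht).pow 2).div_const 2).const_mul (θ * β))).add
      (((h.hasDerivAt_fst t ht).rpow_const (p := q + 1) (Or.inl (h.pos t ht).ne')).div_const
        (q + 1))
    refine h1.congr_deriv ?_
    have hq1 : q + 1 ≠ 0 := by linarith
    unfold emdenFowlerTerm
    rw [add_sub_cancel_right]
    field_simp
    push_cast
    ring
  have hErr := tendsto_exp_mul_bounded_atBot hδ hC
  have hElim : ∃ l, Tendsto E atBot (𝓝 l) := by
    -- Adding a primitive of C e^{θ(q-p)t} to -E absorbs the error term, so the sum is monotone.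
    have hmono := monotoneOn_Iio_of_hasDerivAt_nonneg (T := T)
      (fun t ht => ((hasDerivAt_exp_const_mul (θ * (q - p)) t).const_mul
        (C / (θ * (q - p)))).sub (hEd t ht)) (fun t ht => by
        have h1 : C / (θ * (q - p)) * (θ * (q - p) * Real.exp (θ * (q - p) * t)) =
          Real.exp (θ * (q - p) * t) * C := by
          rw [← mul_assoc, div_mul_cancel₀ _ hδ.ne', mul_comm]
        rw [h1]
        have h2 := mul_le_mul_of_nonneg_left ((neg_abs_le _).trans' (neg_le_neg (hC t ht)))
          (Real.exp_pos (θ * (q - p) * t)).le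
        have h3 : 0 ≤ (β - θ) * w t ^ 2 := by positivity
        linarith)
    obtain ⟨l, hl⟩ := exists_tendsto_atBot_of_monotoneOn_Iio
      (m := -(N ^ 2 / 2 + M ^ (q + 1) / (q + 1))) hmono (fun t ht => by
        simp only [Pi.sub_apply, hE]
        have hv := h.pos t ht
        have h1 : 0 ≤ C / (θ * (q - p)) * Real.exp (θ * (q - p) * t) := by positivity
        have h2 : w t ^ 2 ≤ N ^ 2 := sq_le_sq' (abs_le.1 (hN t ht)).1 (abs_le.1 (hN t ht)).2
        have h3 : v t ^ (q + 1) / (q + 1) ≤ M ^ (q + 1) / (q + 1) := by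
          gcongr
          exact hM t ht
        have h4 : 0 ≤ θ * β * (v t ^ 2 / 2) := by positivity
        linarith)
    refine ⟨-l, ?_⟩
    have := ((tendsto_exp_mul_atBot hδ).const_mul (C / (θ * (q - p)))).sub hl
    simpa using this
  obtain ⟨l, hl⟩ := hElim
  have hsq := tendsto_zero_of_tendsto_of_hasDerivAt (K := (β - θ) * (2 * N *
      (θ * β * M + (β - θ) * N + H))) hEd hl (by simpa using hErr.neg)
    (fun t ht => ((h.hasDerivAt_snd t ht).pow 2).const_mul (-(β - θ))) (fun t ht => by
      have hv := h.pos t ht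
      have hh := h.term_pos hs ht
      have hw : |θ * β * v t - (β - θ) * w t - emdenFowlerTerm θ σ p q t (v t)| ≤
          θ * β * M + (β - θ) * N + H := by
        refine (abs_sub _ _).trans (add_le_add ((abs_sub _ _).trans (add_le_add ?_ ?_)) ?_)
        · rw [abs_of_nonneg (by positivity)]
          gcongr
          exact hM t ht
        · rw [abs_mul, abs_of_pos hα]
          gcongr
          exact hN t ht
        · rw [abs_of_pos hh]
          exact hH t ht
      rw [abs_mul, abs_neg, abs_of_pos hα]
      gcongr
      rw [abs_mul, abs_mul]
      gcongr
      · simp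
      · simpa using hN t ht)
  have h1 : Tendsto (fun t => w t ^ 2) atBot (𝓝 0) := by
    have := hsq.const_mul (-(β - θ))⁻¹
    simp only [mul_zero] at this
    refine this.congr fun t => ?_
    rw [inv_mul_cancel_left₀ (by linarith)]
  have h2 := h1.sqrt
  simp only [Real.sqrt_sq_eq_abs, Real.sqrt_zero] at h2
  exact (tendsto_zero_iff_abs_tendsto_zero w).2 h2

/-- Barbalat's lemma again, now with F = w → 0: the equation splits w' into this balance and terms
that vanish at -∞. -/
theorem tendsto_balance (hs : IsSupercritical θ β σ p q)
    (h : IsEmdenFowlerSolution θ β σ p q T v w) (hT : T ≤ 0) :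
    Tendsto (fun t => θ * β * v t - v t ^ q) atBot (𝓝 0) := by
  obtain ⟨M, hM⟩ := h.exists_bound hs
  obtain ⟨N, hN⟩ := h.exists_deriv_bound hs hT
  have hw := h.tendsto_deriv hs hT
  have hθ := hs.theta_pos
  have hβ : 0 < β := hθ.trans hs.theta_lt
  have hp := hs.one_lt
  have hpq := hs.lt
  have hσ := hs.sigma_nonneg
  have hδ : 0 < θ * (q - p) := mul_pos hθ (by linarith)
  have hp0 : 0 ≤ p := by linarith
  have hq0 : 0 ≤ q := by linarith
  have hN0 : 0 ≤ N := (abs_nonneg _).trans (hN (T - 1) (by linarith))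
  have hErr : Tendsto (fun t => Real.exp (θ * (q - p) * t) * (σ * v t ^ p)) atBot (𝓝 0) :=
    tendsto_exp_mul_bounded_atBot (C := σ * M ^ p) hδ fun t ht => by
      have hv := h.pos t ht
      rw [abs_of_nonneg (by positivity)]
      gcongr
      exact hM t ht
  have hE2 : Tendsto (fun t => -(β - θ) * w t - Real.exp (θ * (q - p) * t) * (σ * v t ^ p))
      atBot (𝓝 0) := by
    simpa using (hw.const_mul (-(β - θ))).sub hErr
  refine tendsto_zero_of_tendsto_of_hasDerivAt (T := T)
    (K := θ * β * N + N * q * M ^ (q - 1)) (fun t ht => ?_) hw hE2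
    (fun t ht => ((h.hasDerivAt_fst t ht).const_mul (θ * β)).sub
      ((h.hasDerivAt_fst t ht).rpow_const (Or.inl (h.pos t ht).ne'))) (fun t ht => ?_)
  · refine (h.hasDerivAt_snd t ht).congr_deriv ?_
    unfold emdenFowlerTerm
    ring
  · have hv := h.pos t ht
    refine (abs_sub _ _).trans (add_le_add ?_ ?_)
    · rw [abs_mul, abs_of_pos (by positivity)]
      gcongr
      exact hN t ht
    · rw [abs_mul, abs_mul, abs_of_nonneg hq0, abs_of_nonneg (Real.rpow_nonneg hv.le _)]
      have : 0 ≤ q - 1 := by linarith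
      gcongr
      · exact hN t ht
      · exact hM t ht

theorem tendsto_zero_or (hs : IsSupercritical θ β σ p q)
    (h : IsEmdenFowlerSolution θ β σ p q T v w) (hT : T ≤ 0) :
    Tendsto v atBot (𝓝 0) ∨ Tendsto v atBot (𝓝 ((θ * β) ^ (1 / (q - 1)))) := by
  have hbal := h.tendsto_balance hs hT
  have hθ := hs.theta_pos
  have hβ : 0 < β := hθ.trans hs.theta_lt
  have hq1 : 0 < q - 1 := by linarith [hs.one_lt, hs.lt]
  have hB : 0 < θ * β := by positivity
  set m := (θ * β / 2) ^ (1 / (q - 1)) with hm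
  have hm0 : 0 < m := by positivity
  have hmq : m ^ (q - 1) = θ * β / 2 := by
    rw [hm, ← Real.rpow_mul (by positivity), one_div_mul_cancel hq1.ne', Real.rpow_one]
  have hfac : ∀ x : ℝ, 0 < x → θ * β * x - x ^ q = x * (θ * β - x ^ (q - 1)) := fun x hx => by
    rw [Real.rpow_sub_one hx.ne']
    field_simp
  -- The level m lies strictly between the zeros 0 and x₀ of θβx - x^q, so the balance forbids
  -- crossing it near -∞; by connectedness v stays on one side.
  have hne : ∀ᶠ t in atBot, v t ≠ m := by
    have h1 : 0 < m * (θ * β / 2) := by positivity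
    filter_upwards [(tendsto_order.1 hbal).2 _ h1] with t ht hcon
    rw [hcon, hfac m hm0, hmq] at ht
    linarith
  obtain ⟨N, hN⟩ := eventually_atBot.1 (hne.and (eventually_lt_atBot T))
  have hcont : ContinuousOn v (Iic N) := fun t ht =>
    (h.hasDerivAt_fst t (hN t ht).2).continuousAt.continuousWithinAt
  have hconn : ∀ a ≤ N, ∀ b ≤ N, v a < m → m < v b → False := by
    intro a ha b hb hva hvb
    obtain ⟨c, hc, hcm⟩ := (isPreconnected_Iic (a := N)).intermediate_value
      (show a ∈ Iic N from ha) (show b ∈ Iic N from hb) hcont ⟨hva.le, hvb.le⟩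
    exact (hN c hc).1 hcm
  rcases lt_or_gt_of_ne (hN N le_rfl).1 with hlt | hgt
  · left
    have hb := (hbal.div_const (θ * β / 2))
    rw [zero_div] at hb
    refine tendsto_of_tendsto_of_tendsto_of_le_of_le' tendsto_const_nhds hb ?_ ?_
    · filter_upwards [eventually_lt_atBot T] with t ht using (h.pos t ht).le
    · filter_upwards [eventually_le_atBot N] with t ht
      have hv := h.pos t (hN t ht).2
      have hvm : v t < m := by
        by_contra! hc
        exact hconn N le_rfl t ht hlt (lt_of_le_of_ne hc (hN t ht).1.symm)
      have h1 : v t ^ (q - 1) ≤ θ * β / 2 := by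
        rw [← hmq]
        gcongr
      rw [hfac _ hv, le_div_iff₀ (by positivity)]
      gcongr
      linarith
  · right
    have hpow : Tendsto (fun t => v t ^ (q - 1)) atBot (𝓝 (θ * β)) := by
      rw [tendsto_iff_norm_sub_tendsto_zero]
      have hb := hbal.norm.div_const m
      rw [norm_zero, zero_div] at hb
      refine squeeze_zero' (Eventually.of_forall fun t => norm_nonneg _) ?_ hb
      filter_upwards [eventually_le_atBot N] with t ht
      have hv := h.pos t (hN t ht).2
      have hvm : m < v t := by
        by_contra! hc
        exact hconn t ht N le_rfl (lt_of_le_of_ne hc (hN t ht).1) hgt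
      rw [hfac _ hv, le_div_iff₀ hm0, norm_mul, norm_sub_rev, Real.norm_of_nonneg hv.le, mul_comm]
      gcongr
    have h2 := hpow.rpow_const (p := 1 / (q - 1)) (Or.inl hB.ne')
    refine h2.congr' ?_
    filter_upwards [eventually_lt_atBot T] with t ht
    rw [← Real.rpow_mul (h.pos t ht).le, mul_one_div_cancel hq1.ne', Real.rpow_one]

/-- At 0 the linearised equation has exponents θ and -β, and v → 0 excludes the second. So v decays
almost like e^{θt}. This makes the nonlinear term small enough that u' is bounded near r = 0, so u
is bounded there, against u → ∞. -/
theorem not_tendsto_zero (hs : IsSupercritical θ β σ p q)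
    (h : IsEmdenFowlerSolution θ β σ p q T v w) (hT : T ≤ 0) : ¬ Tendsto v atBot (𝓝 0) := by
  intro hv0
  have hw0 := h.tendsto_deriv hs hT
  have hθ := hs.theta_pos
  have hβθ := hs.theta_lt
  have hβ : 0 < β := hθ.trans hs.theta_lt
  have hp := hs.one_lt
  have hpq := hs.lt
  have hσ := hs.sigma_nonneg
  have hδ : 0 < θ * (q - p) := mul_pos hθ (by linarith)
  have hp0 : 0 < p := by linarith
  have hq0 : 0 < q := by linarith
  -- The loss a in the decay rate must satisfy q(θ-a) ≥ θq - 1 = θ + 1, so that the nonlinear term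
  -- is O(e^{(θ+1)t}).
  obtain ⟨a, ha0, haθ, haq⟩ : ∃ a, 0 < a ∧ a < θ ∧ q * a ≤ 1 := by
    refine ⟨min (θ / 2) (1 / q), by positivity, (min_le_left _ _).trans_lt (by linarith), ?_⟩
    calc q * min (θ / 2) (1 / q) ≤ q * (1 / q) := by gcongr; exact min_le_right _ _
      _ = 1 := mul_one_div_cancel hq0.ne'
  have hbpos : 0 < β - a := by linarith
  -- the potential `h / v` tends to zero
  have hpot : Tendsto (fun t => v t ^ (q - 1) +
      σ * Real.exp (θ * (q - p) * t) * v t ^ (p - 1)) atBot (𝓝 0) := by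
    have h1 := hv0.rpow_const (p := q - 1) (Or.inr (by linarith))
    have h2 := hv0.rpow_const (p := p - 1) (Or.inr (by linarith))
    have h3 := h1.add (((tendsto_exp_mul_atBot hδ).const_mul σ).mul h2)
    rw [Real.zero_rpow (by linarith), Real.zero_rpow (by linarith)] at h3
    simpa using h3
  obtain ⟨N, hN⟩ := eventually_atBot.1 (((tendsto_order.1 hpot).2 (a * (β - a + θ))
    (by positivity)).and (eventually_lt_atBot T))
  have hNT : ∀ t < N, t < T := fun t ht => (hN t ht.le).2
  -- The function is e^{(β-a)t}(w - (θ-a)v), with derivative e^{(β-a)t}(a(β-a+θ)v - h), where h is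
  -- the nonlinear term. Its sign gives w ≥ (θ-a)v.
  have hφ := nonneg_of_hasDerivAt_nonneg_atBot (T := N)
    (fun t ht => (h.hasDerivAt_flux (β - a) (hNT t ht)).add
      ((h.hasDerivAt_scaled (β - a) (hNT t ht)).const_mul a)) (fun t ht => by
      have hv := h.pos t (hNT t ht)
      have h1 : emdenFowlerTerm θ σ p q t (v t) ≤ a * (β - a + θ) * v t := by
        have : emdenFowlerTerm θ σ p q t (v t) = (v t ^ (q - 1) +
            σ * Real.exp (θ * (q - p) * t) * v t ^ (p - 1)) * v t := by
          unfold emdenFowlerTerm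
          rw [Real.rpow_sub_one hv.ne', Real.rpow_sub_one hv.ne']
          field_simp
        rw [this]
        have := (hN t ht.le).1
        gcongr
      have h2 := mul_le_mul_of_nonneg_left h1 (Real.exp_pos ((β - a) * t)).le
      linarith)
    (by
      have h1 := (tendsto_exp_mul_atBot hbpos).mul ((hw0.sub (hv0.const_mul θ)).add
        (hv0.const_mul a))
      simpa using h1)
    (Eventually.of_forall fun t => le_of_eq (by
      simp only [Pi.add_apply]
      ring))
  have hmono := monotoneOn_Iio_of_hasDerivAt_nonneg (T := N)
    (fun t ht => h.hasDerivAt_scaled (-(θ - a)) (hNT t ht)) (fun t ht => by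
      have h1 := hφ t ht
      simp only [Pi.add_apply] at h1
      have h2 : 0 ≤ Real.exp ((β - a) * t) * (w t - (θ - a) * v t) := by linarith
      have h3 := nonneg_of_mul_nonneg_right h2 (Real.exp_pos _)
      exact mul_nonneg (Real.exp_pos _).le (by linarith))
  set N' := min N 0 - 1 with hN'
  have hN'N : N' < N := by have := min_le_left N 0; linarith
  have hN'0 : N' < 0 := by have := min_le_right N 0; linarith
  set A := Real.exp (-(θ - a) * N') * v N' with hA
  have hA0 : 0 < A := mul_pos (Real.exp_pos _) (h.pos _ (hNT _ hN'N))
  have hdecay : ∀ t < N', v t ≤ A * Real.exp ((θ - a) * t) := fun t ht => by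
    have h1 := hmono (ht.trans hN'N) hN'N ht.le
    have h2 := mul_le_mul_of_nonneg_right h1 (Real.exp_pos ((θ - a) * t)).le
    have h4 : Real.exp (-(θ - a) * t) * Real.exp ((θ - a) * t) = 1 := by
      rw [← Real.exp_add, neg_mul, neg_add_cancel, Real.exp_zero]
    calc v t = Real.exp (-(θ - a) * t) * v t * Real.exp ((θ - a) * t) := by
          rw [mul_right_comm, h4, one_mul]
      _ ≤ _ := h2
  have hscal := hs.scaling
  have hterm : ∀ t < N', emdenFowlerTerm θ σ p q t (v t) ≤
      (A ^ q + σ * A ^ p) * Real.exp ((θ + 1) * t) := fun t ht => by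
    have hv := h.pos t (hNT t (ht.trans hN'N))
    have ht0 : t ≤ 0 := (ht.trans hN'0).le
    have h1 : v t ^ q ≤ A ^ q * Real.exp ((θ + 1) * t) := by
      calc v t ^ q ≤ (A * Real.exp ((θ - a) * t)) ^ q := by gcongr; exact hdecay t ht
        _ = A ^ q * Real.exp ((θ - a) * t * q) := by
          rw [Real.mul_rpow hA0.le (Real.exp_pos _).le, ← Real.exp_mul]
        _ ≤ _ := by
          gcongr A ^ q * Real.exp ?_
          nlinarith
    have h2 : Real.exp (θ * (q - p) * t) * v t ^ p ≤ A ^ p * Real.exp ((θ + 1) * t) := by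
      calc Real.exp (θ * (q - p) * t) * v t ^ p
          ≤ Real.exp (θ * (q - p) * t) * (A * Real.exp ((θ - a) * t)) ^ p := by
            gcongr; exact hdecay t ht
        _ = A ^ p * Real.exp (θ * (q - p) * t + (θ - a) * t * p) := by
          rw [Real.mul_rpow hA0.le (Real.exp_pos _).le, ← Real.exp_mul, Real.exp_add]
          ring
        _ ≤ _ := by
          gcongr A ^ p * Real.exp ?_
          have h5 : p * a ≤ 1 := (mul_le_mul_of_nonneg_right hpq.le ha0.le).trans haq
          nlinarith
    unfold emdenFowlerTerm
    have h3 := mul_le_mul_of_nonneg_left h2 hσ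
    linarith
  set K := A ^ q + σ * A ^ p with hK
  have hK0 : 0 < K := by positivity
  have hb : 0 < β + (θ + 1) := by linarith
  have hflux := nonneg_of_hasDerivAt_nonneg_atBot (T := N')
    (fun t ht => (h.hasDerivAt_flux β (hNT t (ht.trans hN'N))).add
      ((hasDerivAt_exp_const_mul (β + (θ + 1)) t).const_mul (K / (β + (θ + 1)))))
    (fun t ht => by
      have h1 := mul_le_mul_of_nonneg_left (hterm t ht) (Real.exp_pos (β * t)).le
      have h2 : K / (β + (θ + 1)) * ((β + (θ + 1)) * Real.exp ((β + (θ + 1)) * t)) =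
          Real.exp (β * t) * (K * Real.exp ((θ + 1) * t)) := by
        have h3 : Real.exp ((β + (θ + 1)) * t) = Real.exp (β * t) * Real.exp ((θ + 1) * t) := by
          rw [← Real.exp_add, add_mul β]
        rw [h3]
        field_simp
      rw [h2]
      linarith)
    (by
      have h1 := ((tendsto_exp_mul_atBot hβ).mul (hw0.sub (hv0.const_mul θ))).add
        ((tendsto_exp_mul_atBot hb).const_mul (K / (β + (θ + 1))))
      simp only [mul_zero, sub_zero, add_zero] at h1
      exact h1)
    (Eventually.of_forall fun t => le_of_eq rfl)
  -- In radial terms, u + K/(β+θ+1)·r is nondecreasing in r, so u is bounded near 0.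
  have hU := monotoneOn_Iio_of_hasDerivAt_nonneg (T := N')
    (fun t ht => (h.hasDerivAt_scaled (-θ) (hNT t (ht.trans hN'N))).add
      ((hasDerivAt_exp_const_mul 1 t).const_mul (K / (β + (θ + 1))))) (fun t ht => by
      have h1 := hflux t ht
      simp only [Pi.add_apply] at h1
      have h2 : Real.exp ((β + (θ + 1)) * t) = Real.exp (β * t) * Real.exp ((θ + 1) * t) := by
        rw [← Real.exp_add]; ring_nf
      have h3 : 0 ≤ Real.exp (β * t) * (w t - θ * v t + K / (β + (θ + 1)) *
          Real.exp ((θ + 1) * t)) := by rw [h2] at h1; linarith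
      have h4 := nonneg_of_mul_nonneg_right h3 (Real.exp_pos _)
      have h5 : Real.exp (1 * t) = Real.exp (-θ * t) * Real.exp ((θ + 1) * t) := by
        rw [← Real.exp_add]; ring_nf
      rw [h5]
      have h6 := mul_nonneg (Real.exp_pos (-θ * t)).le h4
      linarith)
  obtain ⟨s, hs1, hs2⟩ := ((h.singular.eventually_gt_atTop
    (Real.exp (-θ * (N' - 1)) * v (N' - 1) +
      K / (β + (θ + 1)) * Real.exp (1 * (N' - 1)))).and (eventually_le_atBot (N' - 1))).exists
  have h1 := hU (show s < N' by linarith) (show N' - 1 < N' by linarith) hs2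
  simp only [Pi.add_apply] at h1
  have h2 : 0 ≤ K / (β + (θ + 1)) * Real.exp (1 * s) := by positivity
  linarith

theorem tendsto_equilibrium (hs : IsSupercritical θ β σ p q)
    (h : IsEmdenFowlerSolution θ β σ p q T v w) (hT : T ≤ 0) :
    Tendsto v atBot (𝓝 ((θ * β) ^ (1 / (q - 1)))) :=
  (h.tendsto_zero_or hs hT).resolve_left (h.not_tendsto_zero hs hT)

end IsEmdenFowlerSolution

/-! ### Uniqueness: linearisation, Lyapunov function, Gronwall. -/

/-- Strict differentiability at x₀ lets both points move, as needed to compare two solutions. -/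
theorem eventually_abs_rpow_sub_le {x₀ : ℝ} (hx₀ : 0 < x₀) (r : ℝ) {ε : ℝ} (hε : 0 < ε) :
    ∀ᶠ z : ℝ × ℝ in 𝓝 (x₀, x₀),
      |z.1 ^ r - z.2 ^ r - r * x₀ ^ (r - 1) * (z.1 - z.2)| ≤ ε * |z.1 - z.2| := by
  have h := (Real.hasStrictDerivAt_rpow_const (p := r)
    (Or.inl hx₀.ne')).hasStrictFDerivAt.isLittleO.def hε
  filter_upwards [h] with z hz
  simpa [mul_comm] using hz

theorem exists_lipschitz_rpow_Icc {m : ℝ} (hm : 0 < m) (M r : ℝ) :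
    ∃ K, 0 ≤ K ∧ ∀ x ∈ Icc m M, ∀ y ∈ Icc m M, |x ^ r - y ^ r| ≤ K * |x - y| := by
  have hcont : ContinuousOn (fun x : ℝ => r * x ^ (r - 1)) (Icc m M) :=
    continuousOn_const.mul (continuousOn_id.rpow_const fun x hx =>
      Or.inl (hm.trans_le hx.1).ne')
  obtain ⟨K, hK⟩ := isCompact_Icc.exists_bound_of_continuousOn hcont
  refine ⟨max K 0, le_max_right _ _, fun x hx y hy => ?_⟩
  exact (convex_Icc m M).norm_image_sub_le_of_norm_hasDerivWithin_le
    (f := fun x => x ^ r) (f' := fun x => r * x ^ (r - 1))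
    (fun z hz => (Real.hasDerivAt_rpow_const
      (Or.inl (hm.trans_le hz.1).ne')).hasDerivWithinAt)
    (fun z hz => (hK z hz).trans (le_max_left _ _)) hy hx

/-- The dissipation of `e² / 2 + κ d² / 2 + μ d e` along `d' = e`, `e' = -κ d - α e - ρ` is
nonnegative when `ρ` is small compared with `d`. -/
theorem lyapunov_dissipation_nonneg {α κ μ η d e ρ : ℝ} (hα : 0 < α) (hκ : 0 < κ) (hμ : 0 < μ)
    (hη : 0 < η) (hμ₁ : 4 * α * μ ≤ κ) (hμ₂ : 4 * μ ≤ α) (hη₁ : 2 * η ≤ α)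
    (hη₂ : 2 * η ≤ μ * κ) (hη₃ : 4 * η ≤ κ) (hρ : |ρ| ≤ η * |d|) :
    0 ≤ α * e ^ 2 + e * ρ - μ * e ^ 2 + μ * κ * d ^ 2 + μ * α * (d * e) + μ * (d * ρ) := by
  have h1 : -(η * ((e ^ 2 + d ^ 2) / 2)) ≤ e * ρ := by
    have a1 : |e * ρ| ≤ |e| * (η * |d|) := by rw [abs_mul]; gcongr
    have a2 := neg_abs_le (e * ρ)
    have a3 := mul_le_mul_of_nonneg_left (two_mul_le_add_sq |e| |d|) hη.le
    rw [sq_abs, sq_abs] at a3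
    linarith
  have h2 : -(μ * (η * d ^ 2)) ≤ μ * (d * ρ) := by
    have a1 : |d * ρ| ≤ |d| * (η * |d|) := by rw [abs_mul]; gcongr
    have a2 : |d| * (η * |d|) = η * d ^ 2 := by rw [← sq_abs d]; ring
    rw [← mul_neg]
    exact mul_le_mul_of_nonneg_left (by linarith [neg_abs_le (d * ρ)]) hμ.le
  have h3 : -(μ * κ / 4 * d ^ 2 + α / 4 * e ^ 2) ≤ μ * α * (d * e) := by
    have a1 : 0 ≤ μ * (κ * d + 2 * α * e) ^ 2 := by positivity
    have a2 : 4 * α * μ * (α * e ^ 2) ≤ κ * (α * e ^ 2) := by gcongr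
    have a3 : 0 ≤ κ * (4 * (μ * α * (d * e)) + (μ * κ * d ^ 2 + α * e ^ 2)) := by
      linarith
    have a4 := nonneg_of_mul_nonneg_right a3 hκ
    linarith
  have h4 : 0 ≤ e ^ 2 * (α - η / 2 - μ - α / 4) := mul_nonneg (sq_nonneg _) (by linarith)
  have h5 : 0 ≤ d ^ 2 * (3 * (μ * κ) / 4 - η / 2 - μ * η) := by
    refine mul_nonneg (sq_nonneg _) ?_
    have := mul_le_mul_of_nonneg_left hη₃ hμ.le
    linarith
  linarith

namespace IsEmdenFowlerSolution

variable {θ β σ p q T : ℝ} {v₁ w₁ v₂ w₂ : ℝ → ℝ}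

theorem eqOn_near_atBot (hs : IsSupercritical θ β σ p q)
    (h₁ : IsEmdenFowlerSolution θ β σ p q T v₁ w₁)
    (h₂ : IsEmdenFowlerSolution θ β σ p q T v₂ w₂) (hT : T ≤ 0) :
    ∃ N < T, ∀ t < N, v₁ t = v₂ t ∧ w₁ t = w₂ t := by
  have hθ := hs.theta_pos
  have hβ : 0 < β := hθ.trans hs.theta_lt
  have hσ := hs.sigma_nonneg
  have hp := hs.one_lt
  have hpq := hs.lt
  have hq1 : 0 < q - 1 := by linarith
  have hδ : 0 < θ * (q - p) := mul_pos hθ (by linarith)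
  have hB : 0 < θ * β := by positivity
  obtain ⟨α, hα⟩ : ∃ α, α = β - θ := ⟨_, rfl⟩
  have hα0 : 0 < α := by linarith [hs.theta_lt]
  set x₀ := (θ * β) ^ (1 / (q - 1)) with hx₀
  have hx0 : 0 < x₀ := by positivity
  have hx0q : x₀ ^ (q - 1) = θ * β := by
    rw [hx₀, ← Real.rpow_mul hB.le, one_div_mul_cancel hq1.ne', Real.rpow_one]
  have hv₁ := h₁.tendsto_equilibrium hs hT
  have hv₂ := h₂.tendsto_equilibrium hs hT
  have hw₁ := h₁.tendsto_deriv hs hT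
  have hw₂ := h₂.tendsto_deriv hs hT
  obtain ⟨κ, hκ⟩ : ∃ κ, κ = (q - 1) * (θ * β) := ⟨_, rfl⟩
  have hκ0 : 0 < κ := by rw [hκ]; positivity
  -- 4μ² ≤ κ makes e²/2 + κd²/2 + μde positive definite; the other two bounds absorb the cross terms
  -- in its dissipation.
  obtain ⟨μ, hμ0, hμ1, hμ2, hμ3⟩ : ∃ μ > 0, 4 * μ ^ 2 ≤ κ ∧ 4 * α * μ ≤ κ ∧ 4 * μ ≤ α := by
    refine ⟨min (√κ / 2) (min (κ / (4 * α)) (α / 4)), by positivity, ?_, ?_, ?_⟩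
    · have h1 : min (√κ / 2) (min (κ / (4 * α)) (α / 4)) ≤ √κ / 2 := min_le_left _ _
      have h2 : 0 ≤ min (√κ / 2) (min (κ / (4 * α)) (α / 4)) := by positivity
      have h3 := pow_le_pow_left₀ h2 h1 2
      rw [div_pow, Real.sq_sqrt hκ0.le] at h3
      linarith
    · have h1 : min (√κ / 2) (min (κ / (4 * α)) (α / 4)) ≤ κ / (4 * α) :=
        (min_le_right _ _).trans (min_le_left _ _)
      rw [le_div_iff₀ (by positivity)] at h1
      linarith
    · have h1 : min (√κ / 2) (min (κ / (4 * α)) (α / 4)) ≤ α / 4 :=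
        (min_le_right _ _).trans (min_le_right _ _)
      linarith
  obtain ⟨η, hη0, hη1, hη2, hη3⟩ : ∃ η > 0, 2 * η ≤ α ∧ 2 * η ≤ μ * κ ∧ 4 * η ≤ κ := by
    refine ⟨min (α / 2) (min (μ * κ / 2) (κ / 4)), by positivity, ?_, ?_, ?_⟩
    · have h1 : min (α / 2) (min (μ * κ / 2) (κ / 4)) ≤ α / 2 := min_le_left _ _
      linarith
    · have h1 : min (α / 2) (min (μ * κ / 2) (κ / 4)) ≤ μ * κ / 2 :=
        (min_le_right _ _).trans (min_le_left _ _)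
      linarith
    · have h1 : min (α / 2) (min (μ * κ / 2) (κ / 4)) ≤ κ / 4 :=
        (min_le_right _ _).trans (min_le_right _ _)
      linarith
  have hpair := hv₁.prodMk_nhds hv₂
  have hL : Tendsto (fun t => σ * Real.exp (θ * (q - p) * t) * (|p * x₀ ^ (p - 1)| + 1))
      atBot (𝓝 0) := by
    simpa using ((tendsto_exp_mul_atBot hδ).const_mul σ).mul_const (|p * x₀ ^ (p - 1)| + 1)
  obtain ⟨N, hN⟩ := eventually_atBot.1 (((hpair.eventually
    (eventually_abs_rpow_sub_le hx0 q (half_pos hη0))).and (hpair.eventually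
    (eventually_abs_rpow_sub_le hx0 p one_pos))).and
    (((tendsto_order.1 hL).2 _ (half_pos hη0)).and (eventually_lt_atBot T)))
  -- the linearisation at the equilibrium
  have hlin : ∀ t ≤ N, ∃ ρ, emdenFowlerTerm θ σ p q t (v₁ t) - emdenFowlerTerm θ σ p q t (v₂ t) =
      q * (θ * β) * (v₁ t - v₂ t) + ρ ∧ |ρ| ≤ η * |v₁ t - v₂ t| := by
    intro t ht
    obtain ⟨⟨hq', hp'⟩, hL', -⟩ := hN t ht
    refine ⟨_, (add_sub_cancel _ _).symm, ?_⟩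
    simp only [hx0q] at hq'
    have h1 : |v₁ t ^ p - v₂ t ^ p| ≤ (|p * x₀ ^ (p - 1)| + 1) * |v₁ t - v₂ t| := by
      have h2 := abs_add_le (v₁ t ^ p - v₂ t ^ p - p * x₀ ^ (p - 1) * (v₁ t - v₂ t))
        (p * x₀ ^ (p - 1) * (v₁ t - v₂ t))
      rw [sub_add_cancel, abs_mul (p * x₀ ^ (p - 1))] at h2
      simp only at hp'
      linarith
    have h3 : |σ * Real.exp (θ * (q - p) * t) * (v₁ t ^ p - v₂ t ^ p)| ≤
        η / 2 * |v₁ t - v₂ t| := by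
      rw [abs_mul, abs_of_nonneg (by positivity)]
      calc _ ≤ σ * Real.exp (θ * (q - p) * t) * ((|p * x₀ ^ (p - 1)| + 1) * |v₁ t - v₂ t|) := by
            gcongr
        _ = σ * Real.exp (θ * (q - p) * t) * (|p * x₀ ^ (p - 1)| + 1) * |v₁ t - v₂ t| := by ring
        _ ≤ _ := by gcongr
    have h4 : emdenFowlerTerm θ σ p q t (v₁ t) - emdenFowlerTerm θ σ p q t (v₂ t) -
        q * (θ * β) * (v₁ t - v₂ t) = (v₁ t ^ q - v₂ t ^ q - q * (θ * β) * (v₁ t - v₂ t)) +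
        σ * Real.exp (θ * (q - p) * t) * (v₁ t ^ p - v₂ t ^ p) := by
      unfold emdenFowlerTerm
      ring
    rw [h4]
    refine (abs_add_le _ _).trans ?_
    linarith
  choose! ρ hρ hρle using hlin
  have hNT : ∀ t < N, t < T := fun t ht => (hN t ht.le).2.2
  set d := fun t => v₁ t - v₂ t with hd
  set e := fun t => w₁ t - w₂ t with he
  have hdd : ∀ t < N, HasDerivAt d (e t) t := fun t ht =>
    (h₁.hasDerivAt_fst t (hNT t ht)).sub (h₂.hasDerivAt_fst t (hNT t ht))
  have hed : ∀ t < N, HasDerivAt e (-κ * d t - α * e t - ρ t) t := fun t ht => by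
    refine ((h₁.hasDerivAt_snd t (hNT t ht)).sub (h₂.hasDerivAt_snd t (hNT t ht))).congr_deriv ?_
    have := hρ t ht.le
    rw [hκ, hα]
    simp only [hd, he]
    linear_combination -this
  have hd0 : Tendsto d atBot (𝓝 0) := by simpa using hv₁.sub hv₂
  have he0 : Tendsto e atBot (𝓝 0) := by simpa using hw₁.sub hw₂
  have hV0 : Tendsto (fun t => -(e t ^ 2 / 2 + κ * (d t ^ 2 / 2) + μ * (d t * e t))) atBot
      (𝓝 0) := by
    have := ((((he0.pow 2).div_const 2).add (((hd0.pow 2).div_const 2).const_mul κ)).add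
      ((hd0.mul he0).const_mul μ)).neg
    simpa using this
  -- The Lyapunov function starts from 0 at -∞ and does not increase, so it is ≤ 0; definiteness
  -- then gives d = e = 0.
  have hVle := nonneg_of_hasDerivAt_nonneg_atBot (T := N)
    (φ := fun t => -(e t ^ 2 / 2 + κ * (d t ^ 2 / 2) + μ * (d t * e t)))
    (fun t ht => (((((hed t ht).pow 2).div_const 2).add
      ((((hdd t ht).pow 2).div_const 2).const_mul κ)).add
      (((hdd t ht).mul (hed t ht)).const_mul μ)).neg) (fun t ht => by
      have hr := hρle t ht.le
      have h6 : -((2 : ℕ) * e t ^ (2 - 1) * (-κ * d t - α * e t - ρ t) / 2 +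
          κ * ((2 : ℕ) * d t ^ (2 - 1) * e t / 2) +
          μ * (e t * e t + d t * (-κ * d t - α * e t - ρ t))) =
          α * e t ^ 2 + e t * ρ t - μ * e t ^ 2 + μ * κ * d t ^ 2 + μ * α * (d t * e t) +
          μ * (d t * ρ t) := by
        push_cast
        ring
      rw [h6]
      exact lyapunov_dissipation_nonneg hα0 hκ0 hμ0 hη0 hμ2 hμ3 hη1 hη2 hη3
        (hρle t ht.le)) hV0 (Eventually.of_forall fun t => le_rfl)
  refine ⟨N - 1, by have := (hN N le_rfl).2.2; linarith, fun t ht => ?_⟩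
  have h1 := hVle t (by linarith)
  have h2 : 0 ≤ (e t + 2 * μ * d t) ^ 2 := sq_nonneg _
  have h3 : 4 * μ ^ 2 * d t ^ 2 ≤ κ * d t ^ 2 := by gcongr
  have h4 : 0 ≤ κ * d t ^ 2 := by positivity
  have h5 : 0 ≤ e t ^ 2 := sq_nonneg _
  have h6 : e t ^ 2 + κ * d t ^ 2 ≤ 0 := by linarith
  have h7 : κ * d t ^ 2 = 0 := by linarith
  have h8 : e t ^ 2 = 0 := by linarith
  have h9 : d t = 0 := by simpa [hκ0.ne'] using h7
  have h10 : e t = 0 := by simpa using h8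
  exact ⟨sub_eq_zero.1 h9, sub_eq_zero.1 h10⟩

theorem eq_of_eq_of_le (hs : IsSupercritical θ β σ p q)
    (h₁ : IsEmdenFowlerSolution θ β σ p q T v₁ w₁)
    (h₂ : IsEmdenFowlerSolution θ β σ p q T v₂ w₂) {t₀ t₁ : ℝ} (ht : t₀ ≤ t₁) (ht₁ : t₁ < T)
    (hv : v₁ t₀ = v₂ t₀) (hw : w₁ t₀ = w₂ t₀) : v₁ t₁ = v₂ t₁ := by
  have hθ := hs.theta_pos
  have hβ : 0 < β := hθ.trans hs.theta_lt
  have hσ := hs.sigma_nonneg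
  have hα0 : 0 < β - θ := by linarith [hs.theta_lt]
  have hδ : 0 < θ * (q - p) := mul_pos hθ (by linarith [hs.lt])
  have hsub : ∀ t ∈ Icc t₀ t₁, t < T := fun t h => h.2.trans_lt ht₁
  have hrange : ∀ {v w : ℝ → ℝ}, IsEmdenFowlerSolution θ β σ p q T v w →
      ∃ m M, 0 < m ∧ ∀ t ∈ Icc t₀ t₁, v t ∈ Icc m M := by
    intro v w h
    have hc : ContinuousOn v (Icc t₀ t₁) := fun t ht =>
      (h.hasDerivAt_fst t (hsub t ht)).continuousAt.continuousWithinAt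
    obtain ⟨a, ha, ham⟩ := isCompact_Icc.exists_isMinOn (nonempty_Icc.2 ht) hc
    obtain ⟨b, hb, hbm⟩ := isCompact_Icc.exists_isMaxOn (nonempty_Icc.2 ht) hc
    exact ⟨v a, v b, h.pos a (hsub a ha), fun t ht => ⟨ham ht, hbm ht⟩⟩
  obtain ⟨m₁, M₁, hm₁, hr₁⟩ := hrange h₁
  obtain ⟨m₂, M₂, hm₂, hr₂⟩ := hrange h₂
  have hr₁' : ∀ t ∈ Icc t₀ t₁, v₁ t ∈ Icc (min m₁ m₂) (max M₁ M₂) := fun t ht =>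
    Icc_subset_Icc (min_le_left _ _) (le_max_left _ _) (hr₁ t ht)
  have hr₂' : ∀ t ∈ Icc t₀ t₁, v₂ t ∈ Icc (min m₁ m₂) (max M₁ M₂) := fun t ht =>
    Icc_subset_Icc (min_le_right _ _) (le_max_right _ _) (hr₂ t ht)
  obtain ⟨P, hP0, hP⟩ := exists_lipschitz_rpow_Icc (lt_min hm₁ hm₂) (max M₁ M₂) p
  obtain ⟨Q, hQ0, hQ⟩ := exists_lipschitz_rpow_Icc (lt_min hm₁ hm₂) (max M₁ M₂) q
  set L := Q + σ * Real.exp (θ * (q - p) * t₁) * P with hL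
  have hL0 : 0 ≤ L := by positivity
  have hlip : ∀ t ∈ Icc t₀ t₁, |emdenFowlerTerm θ σ p q t (v₁ t) -
      emdenFowlerTerm θ σ p q t (v₂ t)| ≤ L * |v₁ t - v₂ t| := by
    intro t htt
    have h1 := hP _ (hr₁' t htt) _ (hr₂' t htt)
    have h2 := hQ _ (hr₁' t htt) _ (hr₂' t htt)
    have h3 : |σ * Real.exp (θ * (q - p) * t) * (v₁ t ^ p - v₂ t ^ p)| ≤
        σ * Real.exp (θ * (q - p) * t₁) * (P * |v₁ t - v₂ t|) := by
      rw [abs_mul, abs_of_nonneg (by positivity)]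
      gcongr
      exact htt.2
    have h4 : emdenFowlerTerm θ σ p q t (v₁ t) - emdenFowlerTerm θ σ p q t (v₂ t) =
        (v₁ t ^ q - v₂ t ^ q) + σ * Real.exp (θ * (q - p) * t) * (v₁ t ^ p - v₂ t ^ p) := by
      unfold emdenFowlerTerm
      ring
    rw [h4, hL]
    refine (abs_add_le _ _).trans ?_
    linarith
  set d := fun t => v₁ t - v₂ t with hd
  set e := fun t => w₁ t - w₂ t with he
  set r := fun t => emdenFowlerTerm θ σ p q t (v₁ t) - emdenFowlerTerm θ σ p q t (v₂ t) with hr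
  have hdd : ∀ t ∈ Icc t₀ t₁, HasDerivAt d (e t) t := fun t ht =>
    (h₁.hasDerivAt_fst t (hsub t ht)).sub (h₂.hasDerivAt_fst t (hsub t ht))
  have hed : ∀ t ∈ Icc t₀ t₁, HasDerivAt e (θ * β * d t - (β - θ) * e t - r t) t := fun t ht => by
    refine ((h₁.hasDerivAt_snd t (hsub t ht)).sub
      (h₂.hasDerivAt_snd t (hsub t ht))).congr_deriv ?_
    simp only [hd, he, hr]
    ring
  -- Gronwall constant: (d² + e²)' ≤ K(d² + e²), the damping term having a favourable sign.
  set K := 1 + θ * β + L with hK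
  have hVd : ∀ t ∈ Icc t₀ t₁, HasDerivAt (fun t => Real.exp (-K * t) * (d t ^ 2 + e t ^ 2))
      (Real.exp (-K * t) * (-K * (d t ^ 2 + e t ^ 2) + 2 * d t * e t +
        2 * e t * (θ * β * d t - (β - θ) * e t - r t))) t := fun t ht => by
    refine ((hasDerivAt_exp_const_mul (-K) t).mul
      (((hdd t ht).pow 2).add ((hed t ht).pow 2))).congr_deriv ?_
    simp only [Pi.add_apply, Pi.pow_apply]
    push_cast
    ring
  have hanti : AntitoneOn (fun t => Real.exp (-K * t) * (d t ^ 2 + e t ^ 2)) (Icc t₀ t₁) := by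
    refine antitoneOn_of_deriv_nonpos (convex_Icc _ _)
      (fun t ht => (hVd t ht).continuousAt.continuousWithinAt)
      (fun t ht => (hVd t (interior_subset ht)).differentiableAt.differentiableWithinAt)
      (fun t ht => ?_)
    rw [(hVd t (interior_subset ht)).deriv]
    refine mul_nonpos_of_nonneg_of_nonpos (Real.exp_pos _).le ?_
    have h1 := hlip t (interior_subset ht)
    have h2 : -(2 * e t * r t) ≤ L * (d t ^ 2 + e t ^ 2) := by
      have a1 : |e t * r t| ≤ |e t| * (L * |d t|) := by rw [abs_mul]; gcongr
      have a2 := neg_abs_le (e t * r t)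
      have a3 := mul_le_mul_of_nonneg_left (two_mul_le_add_sq |e t| |d t|) hL0
      rw [sq_abs, sq_abs] at a3
      nlinarith
    have h3 : 2 * d t * e t ≤ d t ^ 2 + e t ^ 2 := two_mul_le_add_sq _ _
    have h4 := mul_le_mul_of_nonneg_left h3 (mul_pos hθ hβ).le
    have h5 : 0 ≤ (β - θ) * e t ^ 2 := by positivity
    rw [hK]
    linarith
  have h1 := hanti (left_mem_Icc.2 ht) (right_mem_Icc.2 ht) ht
  simp only [hd, he, hv, hw, sub_self] at h1
  have h2 : Real.exp (-K * t₁) * ((v₁ t₁ - v₂ t₁) ^ 2 + (w₁ t₁ - w₂ t₁) ^ 2) ≤ 0 := by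
    simpa using h1
  have h3 : (v₁ t₁ - v₂ t₁) ^ 2 + (w₁ t₁ - w₂ t₁) ^ 2 ≤ 0 :=
    nonpos_of_mul_nonpos_right h2 (Real.exp_pos _)
  have h4 : (v₁ t₁ - v₂ t₁) ^ 2 = 0 := by
    have := sq_nonneg (v₁ t₁ - v₂ t₁)
    have := sq_nonneg (w₁ t₁ - w₂ t₁)
    linarith
  exact sub_eq_zero.1 (by simpa using h4)

theorem unique (hs : IsSupercritical θ β σ p q)
    (h₁ : IsEmdenFowlerSolution θ β σ p q T v₁ w₁)
    (h₂ : IsEmdenFowlerSolution θ β σ p q T v₂ w₂) {t : ℝ} (ht : t < T) : v₁ t = v₂ t := by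
  -- Restricting to T ≤ 0 keeps e^{θ(q-p)t} ≤ 1, as the a priori bounds require.
  obtain ⟨N, -, hN⟩ := (h₁.mono (min_le_left T 0)).eqOn_near_atBot hs
    (h₂.mono (min_le_left T 0)) (min_le_right T 0)
  have h := hN (min t (N - 1)) ((min_le_right _ _).trans_lt (by linarith))
  exact h₁.eq_of_eq_of_le hs h₂ (min_le_left _ _) ht h.1 h.2

end IsEmdenFowlerSolution

/-! ### Existence: bounded solutions by contraction. -/

/-- The solution `∫_{-∞}^t e^{-c(t - s)} g(s) ds` of `y' + c y = g`. -/
noncomputable def expConvolution (c : ℂ) (g : ℝ → ℂ) (t : ℝ) : ℂ :=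
  Complex.exp (-(c * t)) * ∫ s in Iic t, Complex.exp (c * s) * g s

section expConvolution

variable {c : ℂ} {g g₁ g₂ : ℝ → ℂ} {C : ℝ}

theorem integrableOn_exp_mul_bounded_Iic (hc : 0 < c.re) (hg : Continuous g)
    (hC : ∀ t, ‖g t‖ ≤ C) (t : ℝ) :
    MeasureTheory.IntegrableOn (fun s : ℝ => Complex.exp (c * s) * g s) (Iic t) := by
  refine MeasureTheory.Integrable.mul_bdd (c := C) (integrableOn_exp_mul_complex_Iic hc t)
    hg.aestronglyMeasurable (Eventually.of_forall hC)

theorem hasDerivAt_expConvolution (hc : 0 < c.re) (hg : Continuous g) (hC : ∀ t, ‖g t‖ ≤ C)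
    (t : ℝ) : HasDerivAt (expConvolution c g) (g t - c * expConvolution c g t) t := by
  have hint := integrableOn_exp_mul_bounded_Iic hc hg hC
  have hcont : Continuous fun s : ℝ => Complex.exp (c * s) * g s := by fun_prop
  have h1 : HasDerivAt (fun t : ℝ => ∫ s in Iic t, Complex.exp (c * s) * g s)
      (Complex.exp (c * t) * g t) t := by
    have h2 := (hcont.integral_hasStrictDerivAt 0 t).hasDerivAt.const_add
      (∫ s in Iic (0 : ℝ), Complex.exp (c * s) * g s)
    refine h2.congr_of_eventuallyEq (Eventually.of_forall fun x => ?_)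
    simp only
    rw [← intervalIntegral.integral_Iic_sub_Iic (hint 0) (hint x)]
    ring
  have h3 : HasDerivAt (fun t : ℝ => Complex.exp (-(c * t)))
      (Complex.exp (-(c * t)) * -(c * 1)) t :=
    ((((hasDerivAt_id (t : ℂ)).const_mul c).neg).cexp).comp_ofReal
  refine (h3.mul h1).congr_deriv ?_
  have h4 : Complex.exp (-(c * t)) * Complex.exp (c * t) = 1 := by
    rw [← Complex.exp_add]; simp
  unfold expConvolution
  linear_combination g t * h4

theorem continuous_expConvolution (hc : 0 < c.re) (hg : Continuous g) (hC : ∀ t, ‖g t‖ ≤ C) :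
    Continuous (expConvolution c g) :=
  continuous_iff_continuousAt.2 fun t => (hasDerivAt_expConvolution hc hg hC t).continuousAt

theorem norm_expConvolution_le (hc : 0 < c.re) (hC : ∀ t, ‖g t‖ ≤ C) (t : ℝ) :
    ‖expConvolution c g t‖ ≤ C / c.re := by
  have h1 : ‖∫ s in Iic t, Complex.exp (c * s) * g s‖ ≤ Real.exp (c.re * t) / c.re * C := by
    rw [← integral_exp_mul_Iic hc, ← MeasureTheory.integral_mul_const]
    refine MeasureTheory.norm_integral_le_of_norm_le
      ((integrableOn_exp_mul_Iic hc t).mul_const C) (Eventually.of_forall fun s => ?_)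
    rw [norm_mul, Complex.norm_exp]
    have : (c * s).re = c.re * s := by simp
    rw [this]
    exact mul_le_mul_of_nonneg_left (hC s) (Real.exp_pos _).le
  unfold expConvolution
  rw [norm_mul, Complex.norm_exp]
  have h2 : (-(c * (t : ℂ))).re = -(c.re * t) := by simp
  rw [h2]
  calc _ ≤ Real.exp (-(c.re * t)) * (Real.exp (c.re * t) / c.re * C) := by gcongr
    _ = Real.exp (-(c.re * t)) * Real.exp (c.re * t) * (C / c.re) := by ring
    _ = C / c.re := by rw [← Real.exp_add]; simp

theorem expConvolution_sub (hc : 0 < c.re) (hg₁ : Continuous g₁) (hg₂ : Continuous g₂)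
    {C₁ C₂ : ℝ} (hC₁ : ∀ t, ‖g₁ t‖ ≤ C₁) (hC₂ : ∀ t, ‖g₂ t‖ ≤ C₂) (t : ℝ) :
    expConvolution c g₁ t - expConvolution c g₂ t =
      expConvolution c (fun s => g₁ s - g₂ s) t := by
  unfold expConvolution
  rw [← mul_sub, ← MeasureTheory.integral_sub (integrableOn_exp_mul_bounded_Iic hc hg₁ hC₁ t)
    (integrableOn_exp_mul_bounded_Iic hc hg₂ hC₂ t)]
  simp only [mul_sub]

end expConvolution

/-- The roots of `X² - α X + κ` have positive real part when `α, κ > 0`. -/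
theorem exists_add_eq_mul_eq_re_pos {α κ : ℝ} (hα : 0 < α) (hκ : 0 < κ) :
    ∃ a b : ℂ, a + b = α ∧ a * b = κ ∧ 0 < a.re ∧ 0 < b.re := by
  -- The roots are α/2 ± s. Either s is real and |s| < α/2 because κ > 0, or s is purely imaginary.
  obtain ⟨s, hs, hsα⟩ : ∃ s : ℂ, s ^ 2 = ((α ^ 2 / 4 - κ : ℝ) : ℂ) ∧ |s.re| < α / 2 := by
    rcases le_or_gt 0 (α ^ 2 / 4 - κ) with h | h
    · refine ⟨(√(α ^ 2 / 4 - κ) : ℝ), ?_, ?_⟩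
      · rw [← Complex.ofReal_pow, Real.sq_sqrt h]
      · rw [Complex.ofReal_re, abs_of_nonneg (Real.sqrt_nonneg _), Real.sqrt_lt' (by positivity)]
        linarith
    · refine ⟨(√(-(α ^ 2 / 4 - κ)) : ℝ) * Complex.I, ?_, ?_⟩
      · rw [mul_pow, ← Complex.ofReal_pow, Real.sq_sqrt (by linarith), Complex.I_sq]
        push_cast
        ring
      · simpa using hα
  rw [abs_lt] at hsα
  refine ⟨((α / 2 : ℝ) : ℂ) + s, ((α / 2 : ℝ) : ℂ) - s, ?_, ?_, ?_, ?_⟩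
  · push_cast
    ring
  · push_cast at hs ⊢
    linear_combination -hs
  · rw [Complex.add_re, Complex.ofReal_re]
    linarith [hsα.1]
  · rw [Complex.sub_re, Complex.ofReal_re]
    linarith [hsα.2]

/-- A damped oscillator with a small bounded Lipschitz nonlinear forcing has a bounded solution
on the whole line. -/
theorem exists_bounded_solution {α κ : ℝ} (hα : 0 < α) (hκ : 0 < κ) :
    ∃ c > 0, ∀ (H : ℝ → ℝ → ℝ) (C ε : ℝ), Continuous (fun z : ℝ × ℝ => H z.1 z.2) →
      (∀ t x, |H t x| ≤ C) → (∀ t x y, |H t x - H t y| ≤ ε * |x - y|) → 0 ≤ ε → ε < c →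
      ∃ x w : ℝ → ℝ, (∀ t, HasDerivAt x (w t) t) ∧
        (∀ t, HasDerivAt w (H t (x t) - α * w t - κ * x t) t) ∧ ∀ t, |x t| ≤ C / c := by
  -- With D = d/dt, D² + αD + κ = (D + a)(D + b), and each factor is inverted by `expConvolution`
  -- with sup-norm at most 1/Re. The threshold c is therefore Re a · Re b.
  obtain ⟨a, b, hab, habm, ha, hb⟩ := exists_add_eq_mul_eq_re_pos hα hκ
  refine ⟨b.re * a.re, by positivity, fun H C ε hH hHC hHε hε hεc => ?_⟩
  -- The roots may be non-real, so the fixed point is sought among complex functions. Only its real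
  -- part is fed to H, and that real part solves the equation because α and κ are real.
  set G : BoundedContinuousFunction ℝ ℂ → ℝ → ℂ := fun x t => (H t (x t).re : ℂ) with hG
  have hGc : ∀ x, Continuous (G x) := fun x => Complex.continuous_ofReal.comp
    (hH.comp (continuous_id.prodMk (Complex.continuous_re.comp x.continuous)))
  have hGC : ∀ x t, ‖G x t‖ ≤ C := fun x t => by
    rw [hG, Complex.norm_real]
    exact hHC _ _
  set Y := fun x => expConvolution b (G x) with hY
  have hYc : ∀ x, Continuous (Y x) := fun x => continuous_expConvolution hb (hGc x) (hGC x)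
  have hYC : ∀ x t, ‖Y x t‖ ≤ C / b.re := fun x t => norm_expConvolution_le hb (hGC x) t
  set Φ : BoundedContinuousFunction ℝ ℂ → BoundedContinuousFunction ℝ ℂ := fun x =>
    BoundedContinuousFunction.ofNormedAddCommGroup (expConvolution a (Y x))
      (continuous_expConvolution ha (hYc x) (hYC x)) (C / b.re / a.re)
      (fun t => norm_expConvolution_le ha (hYC x) t) with hΦ
  have hΦa : ∀ x t, Φ x t = expConvolution a (Y x) t := fun x t => rfl
  have hlip : LipschitzWith (ε / (b.re * a.re)).toNNReal Φ := by
    refine LipschitzWith.of_dist_le_mul fun x y => ?_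
    rw [Real.coe_toNNReal _ (by positivity)]
    refine (BoundedContinuousFunction.dist_le (by positivity)).2 fun t => ?_
    rw [dist_eq_norm, hΦa, hΦa, expConvolution_sub ha (hYc x) (hYc y) (hYC x) (hYC y)]
    have h1 : ∀ s, ‖Y x s - Y y s‖ ≤ ε * dist x y / b.re := fun s => by
      rw [hY]
      simp only
      rw [expConvolution_sub hb (hGc x) (hGc y) (hGC x) (hGC y)]
      refine norm_expConvolution_le hb (fun r => ?_) s
      rw [hG]
      simp only
      rw [← Complex.ofReal_sub, Complex.norm_real]
      refine (hHε r _ _).trans (mul_le_mul_of_nonneg_left ?_ hε)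
      rw [← Complex.sub_re]
      refine (Complex.abs_re_le_norm _).trans ?_
      rw [← dist_eq_norm]
      exact BoundedContinuousFunction.dist_coe_le_dist r
    refine (norm_expConvolution_le ha h1 t).trans (le_of_eq ?_)
    field_simp
  have hcontr : ContractingWith (ε / (b.re * a.re)).toNNReal Φ := by
    refine ⟨?_, hlip⟩
    rw [Real.toNNReal_lt_one, div_lt_one (by positivity)]
    exact hεc
  set x := hcontr.fixedPoint with hx
  have hfix : ∀ t, x t = expConvolution a (Y x) t := fun t => by
    rw [← hΦa, hcontr.fixedPoint_isFixedPt]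
  have hfix' : (x : ℝ → ℂ) = expConvolution a (Y x) := funext hfix
  have hxd : ∀ t, HasDerivAt x (Y x t - a * x t) t := fun t => by
    rw [hfix']
    exact hasDerivAt_expConvolution ha (hYc x) (hYC x) t
  have hYd : ∀ t, HasDerivAt (Y x) (G x t - b * Y x t) t := fun t =>
    hasDerivAt_expConvolution hb (hGc x) (hGC x) t
  have hre : ∀ {f : ℝ → ℂ} {f' : ℂ} {t : ℝ}, HasDerivAt f f' t →
      HasDerivAt (fun s => (f s).re) f'.re t := fun h =>
    (Complex.reCLM.hasFDerivAt.comp_hasDerivAt _ h)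
  refine ⟨fun t => (x t).re, fun t => (Y x t - a * x t).re, fun t => hre (hxd t), fun t => ?_,
    fun t => ?_⟩
  · refine (hre ((hYd t).sub ((hxd t).const_mul a))).congr_deriv ?_
    have h1 : G x t - b * Y x t - a * (Y x t - a * x t) =
        (H t (x t).re : ℂ) - (α : ℂ) * (Y x t - a * x t) - (κ : ℂ) * x t := by
      rw [← hab, ← habm]
      simp only [hG]
      ring
    rw [h1, Complex.sub_re, Complex.sub_re, Complex.re_ofReal_mul, Complex.re_ofReal_mul,
      Complex.ofReal_re]
  · refine (Complex.abs_re_le_norm _).trans ?_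
    rw [hfix, ← div_div]
    exact norm_expConvolution_le ha (hYC x) t

/-- Write v = x₀ + x. The unknown x satisfies a damped oscillator whose forcing is the Taylor
remainder of v^q plus the fading p-term, truncated so as to be globally small and Lipschitz. -/
theorem exists_isEmdenFowlerSolution {θ β σ p q : ℝ} (hs : IsSupercritical θ β σ p q) :
    ∃ (T : ℝ) (v w : ℝ → ℝ), IsEmdenFowlerSolution θ β σ p q T v w := by
  have hθ := hs.theta_pos
  have hβ : 0 < β := hθ.trans hs.theta_lt
  have hσ := hs.sigma_nonneg
  have hp := hs.one_lt
  have hpq := hs.lt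
  have hp0 : 0 ≤ p := by linarith
  have hq0 : 0 ≤ q := by linarith
  have hq1 : 0 < q - 1 := by linarith
  have hδ : 0 < θ * (q - p) := mul_pos hθ (by linarith)
  have hB : 0 < θ * β := by positivity
  have hα0 : 0 < β - θ := by linarith [hs.theta_lt]
  set x₀ := (θ * β) ^ (1 / (q - 1)) with hx₀
  have hx0 : 0 < x₀ := by positivity
  have hx0q : x₀ ^ (q - 1) = θ * β := by
    rw [hx₀, ← Real.rpow_mul hB.le, one_div_mul_cancel hq1.ne', Real.rpow_one]
  have hx0q' : x₀ ^ q = θ * β * x₀ := by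
    rw [← hx0q, Real.rpow_sub_one hx0.ne', div_mul_cancel₀ _ hx0.ne']
  obtain ⟨c, hc, hsol⟩ := exists_bounded_solution hα0 (mul_pos hq1 hB)
  obtain ⟨r₀, hr₀, hball⟩ := Metric.eventually_nhds_iff.1
    ((eventually_abs_rpow_sub_le hx0 q (show 0 < c / 4 by positivity)).and
      (eventually_abs_rpow_sub_le hx0 p one_pos))
  obtain ⟨r, hr, hrr₀, hrx⟩ : ∃ r > 0, r < r₀ ∧ r < x₀ :=
    ⟨min r₀ x₀ / 2, by positivity,
      by have := min_le_left r₀ x₀; linarith, by have := min_le_right r₀ x₀; linarith⟩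
  have hest : ∀ x y, |x| ≤ r → |y| ≤ r →
      |(x₀ + x) ^ q - (x₀ + y) ^ q - q * (θ * β) * (x - y)| ≤ c / 4 * |x - y| ∧
      |(x₀ + x) ^ p - (x₀ + y) ^ p| ≤ (|p * x₀ ^ (p - 1)| + 1) * |x - y| := by
    intro x y hx hy
    have h1 := @hball (x₀ + x, x₀ + y) (by
      rw [Prod.dist_eq, max_lt_iff]
      simp only [Real.dist_eq, add_sub_cancel_left]
      exact ⟨hx.trans_lt hrr₀, hy.trans_lt hrr₀⟩)
    simp only [add_sub_add_left_eq_sub, hx0q] at h1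
    refine ⟨h1.1, ?_⟩
    have h2 := abs_add_le ((x₀ + x) ^ p - (x₀ + y) ^ p - p * x₀ ^ (p - 1) * (x - y))
      (p * x₀ ^ (p - 1) * (x - y))
    rw [sub_add_cancel, abs_mul (p * x₀ ^ (p - 1))] at h2
    linarith [h1.2]
  have hlim : ∀ A : ℝ, Tendsto (fun t => σ * Real.exp (θ * (q - p) * t) * A) atBot (𝓝 0) :=
    fun A => by simpa using ((tendsto_exp_mul_atBot hδ).const_mul σ).mul_const A
  -- For t ≤ T the p-term contributes at most c/4 to the Lipschitz constant and (c/4)r to the size;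
  -- the Taylor remainder contributes as much again. The totals c/2 and (c/2)r give |x| ≤ r/2, so
  -- the truncation is inactive.
  obtain ⟨T, hT1, hT2⟩ := (((tendsto_order.1 (hlim (|p * x₀ ^ (p - 1)| + 1))).2 (c / 4)
    (by positivity)).and ((tendsto_order.1 (hlim ((x₀ + r) ^ p))).2 (c / 4 * r)
    (by positivity))).exists
  set cl : ℝ → ℝ := fun x => max (min x r) (-r) with hcl
  have hclc : Continuous cl := by fun_prop
  have hclr : ∀ x, |cl x| ≤ r := fun x => abs_le.2
    ⟨le_max_right _ _, max_le (min_le_right _ _) (by linarith)⟩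
  have hcll : ∀ x y, |cl x - cl y| ≤ |x - y| := fun x y => by
    refine (abs_max_sub_max_le_abs _ _ _).trans ((abs_min_sub_min_le_max _ _ _ _).trans ?_)
    simp
  have hcle : ∀ x, |x| ≤ r → cl x = x := fun x hx => by
    rw [abs_le] at hx
    simp only [hcl]
    rw [min_eq_left hx.2, max_eq_left hx.1]
  -- `min t T` freezes the exponential coefficient beyond T, so the bounds hold on the whole line;
  -- the original equation is recovered for t < T.
  set H : ℝ → ℝ → ℝ := fun t x => -((x₀ + cl x) ^ q - x₀ ^ q - q * (θ * β) * cl x) -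
    σ * Real.exp (θ * (q - p) * min t T) * (x₀ + cl x) ^ p with hH
  have hHc : Continuous fun z : ℝ × ℝ => H z.1 z.2 := by
    have h1 : Continuous fun z : ℝ × ℝ => x₀ + cl z.2 := by fun_prop
    have h2 := h1.rpow_const (p := q) fun _ => Or.inr hq0
    have h3 := h1.rpow_const (p := p) fun _ => Or.inr hp0
    simp only [hH]
    fun_prop
  have hpos : ∀ x, 0 < x₀ + cl x := fun x => by linarith [(abs_le.1 (hclr x)).1]
  obtain ⟨x, w, hxd, hwd, hxb⟩ := hsol H (c / 2 * r) (c / 2) hHc (fun t x => by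
      have h1 := (hest (cl x) 0 (hclr x) (by simpa using hr.le)).1
      rw [add_zero, sub_zero] at h1
      have h2 : σ * Real.exp (θ * (q - p) * min t T) * (x₀ + cl x) ^ p ≤ c / 4 * r := by
        refine le_trans ?_ hT2.le
        have := hpos x
        gcongr
        · exact min_le_right _ _
        · exact (le_abs_self _).trans (hclr x)
      have h3 : 0 ≤ σ * Real.exp (θ * (q - p) * min t T) * (x₀ + cl x) ^ p := by
        have := hpos x
        positivity
      have h4 : c / 4 * |cl x| ≤ c / 4 * r := by
        gcongr
        exact hclr x
      refine (abs_sub _ _).trans ?_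
      rw [abs_neg, abs_of_nonneg h3]
      linarith) (fun t x y => by
      obtain ⟨h1, h2⟩ := hest (cl x) (cl y) (hclr x) (hclr y)
      have h3 : |σ * Real.exp (θ * (q - p) * min t T) * ((x₀ + cl x) ^ p - (x₀ + cl y) ^ p)| ≤
          c / 4 * |cl x - cl y| := by
        rw [abs_mul, abs_of_nonneg (by positivity)]
        calc _ ≤ σ * Real.exp (θ * (q - p) * T) *
              ((|p * x₀ ^ (p - 1)| + 1) * |cl x - cl y|) := by
              gcongr
              exact min_le_right _ _
          _ = σ * Real.exp (θ * (q - p) * T) * (|p * x₀ ^ (p - 1)| + 1) * |cl x - cl y| := by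
            ring
          _ ≤ _ := by gcongr
      have h4 : H t x - H t y =
          -((x₀ + cl x) ^ q - (x₀ + cl y) ^ q - q * (θ * β) * (cl x - cl y)) -
          σ * Real.exp (θ * (q - p) * min t T) * ((x₀ + cl x) ^ p - (x₀ + cl y) ^ p) := by
        simp only [hH]
        ring
      have h5 : c / 2 * |cl x - cl y| ≤ c / 2 * |x - y| :=
        mul_le_mul_of_nonneg_left (hcll x y) (by positivity)
      rw [h4]
      refine (abs_sub _ _).trans ?_
      rw [abs_neg]
      linarith) (by positivity) (by linarith)
  have hxr : ∀ t, |x t| ≤ r / 2 := fun t => by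
    refine (hxb t).trans (le_of_eq ?_)
    field_simp
  have hclx : ∀ t, cl (x t) = x t := fun t => hcle _ (by linarith [hxr t])
  refine ⟨T, fun t => x₀ + x t, w, ⟨fun t _ => ?_, fun t _ => (hxd t).const_add x₀,
    fun t ht => ?_, ?_⟩⟩
  · have := hpos (x t)
    rwa [hclx] at this
  · refine (hwd t).congr_deriv ?_
    simp only [hH, hclx, min_eq_left ht.le, emdenFowlerTerm]
    linear_combination hx0q'
  · have h1 : Tendsto (fun t => Real.exp (-θ * t)) atBot atTop :=
      Real.tendsto_exp_atTop.comp (tendsto_id.const_mul_atBot_of_neg (by linarith))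
    refine tendsto_atTop_mono (fun t => ?_) (h1.atTop_mul_const (show 0 < x₀ - r by linarith))
    have := (abs_le.1 (hxr t)).1
    gcongr
    linarith

/-! ### Passage between the radial and Emden-Fowler equations. -/

theorem contDiffOn_two_of_hasDerivAt {s : Set ℝ} (hs : IsOpen s) {u u₁ u₂ : ℝ → ℝ}
    (h₁ : ∀ r ∈ s, HasDerivAt u (u₁ r) r) (h₂ : ∀ r ∈ s, HasDerivAt u₁ (u₂ r) r)
    (hc : ContinuousOn u₂ s) : ContDiffOn ℝ 2 u s := by
  have hone : ContDiffOn ℝ 1 u₁ s := by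
    rw [show (1 : WithTop ℕ∞) = 0 + 1 by simp, contDiffOn_succ_iff_deriv_of_isOpen hs]
    refine ⟨fun r hr => (h₂ r hr).differentiableAt.differentiableWithinAt, by simp, ?_⟩
    exact contDiffOn_zero.2 (hc.congr fun r hr => (h₂ r hr).deriv)
  rw [show (2 : WithTop ℕ∞) = 1 + 1 by norm_num, contDiffOn_succ_iff_deriv_of_isOpen hs]
  exact ⟨fun r hr => (h₁ r hr).differentiableAt.differentiableWithinAt, by simp,
    hone.congr fun r hr => (h₁ r hr).deriv⟩

theorem hasDerivAt_rpow_mul_comp_log {g : ℝ → ℝ} {g' r : ℝ} (a : ℝ) (hr : 0 < r)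
    (hg : HasDerivAt g g' (Real.log r)) :
    HasDerivAt (fun x => x ^ a * g (Real.log x))
      (r ^ (a - 1) * (a * g (Real.log r) + g')) r := by
  refine ((Real.hasDerivAt_rpow_const (p := a) (Or.inl hr.ne')).mul
    (hg.comp r (Real.hasDerivAt_log hr.ne'))).congr_deriv ?_
  rw [Real.rpow_sub_one hr.ne']
  simp only [Function.comp_apply]
  field_simp

section EmdenFowlerTransform

variable {n : ℕ} {θ σ p q : ℝ}

/-- The Emden-Fowler change of variables. -/
theorem IsSingularSolution.isEmdenFowlerSolution {R : ℝ} {u : ℝ → ℝ}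
    (hs : IsSupercritical θ ((n : ℝ) - 2 - θ) σ p q)
    (h : IsSingularSolution n (fun x => σ * x ^ p + x ^ q) R u) :
    IsEmdenFowlerSolution θ ((n : ℝ) - 2 - θ) σ p q (Real.log R)
      (fun t => Real.exp (θ * t) * u (Real.exp t))
      (fun t => Real.exp (θ * t) * (θ * u (Real.exp t) + Real.exp t * deriv u (Real.exp t))) := by
  have hmem : ∀ t < Real.log R, Real.exp t ∈ Ioo 0 R := fun t ht =>
    ⟨Real.exp_pos _, (Real.lt_log_iff_exp_lt h.radius_pos).1 ht⟩
  have hcd := h.contDiffOn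
  rw [show (2 : WithTop ℕ∞) = 1 + 1 by norm_num, contDiffOn_succ_iff_deriv_of_isOpen isOpen_Ioo]
    at hcd
  have hu : ∀ r ∈ Ioo 0 R, HasDerivAt u (deriv u r) r := fun r hr =>
    ((hcd.1 r hr).differentiableAt (isOpen_Ioo.mem_nhds hr)).hasDerivAt
  have hu' : ∀ r ∈ Ioo 0 R, HasDerivAt (deriv u) (deriv (deriv u) r) r := fun r hr =>
    (((hcd.2.2.differentiableOn one_ne_zero) r hr).differentiableAt
      (isOpen_Ioo.mem_nhds hr)).hasDerivAt
  have hexp := hasDerivAt_exp_const_mul θ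
  refine ⟨fun t ht => mul_pos (Real.exp_pos _) (h.pos _ (hmem t ht)), fun t ht => ?_,
    fun t ht => ?_, ?_⟩
  · refine ((hexp t).mul ((hu _ (hmem t ht)).comp t (Real.hasDerivAt_exp t))).congr_deriv ?_
    simp only [Function.comp_apply]
    ring
  · have hr := hmem t ht
    refine ((hexp t).mul ((((hu _ hr).comp t (Real.hasDerivAt_exp t)).const_mul θ).add
      ((Real.hasDerivAt_exp t).mul ((hu' _ hr).comp t (Real.hasDerivAt_exp t))))).congr_deriv ?_
    have heq := h.equation _ hr
    have hup := h.pos _ hr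
    have he0 : Real.exp t ≠ 0 := (Real.exp_pos t).ne'
    -- Since θq = θ + 2, the power v^q scales like e^{θt} r² u^q. The coefficient e^{θ(q-p)t} gives
    -- the p-term the same scaling.
    have hq : (Real.exp (θ * t) * u (Real.exp t)) ^ q =
        Real.exp (θ * t) * Real.exp t ^ 2 * u (Real.exp t) ^ q := by
      rw [Real.mul_rpow (Real.exp_pos _).le hup.le, ← Real.exp_mul, ← Real.exp_nat_mul,
        ← Real.exp_add]
      congr 2
      push_cast
      linear_combination t * hs.scaling
    have hp : Real.exp (θ * (q - p) * t) * (Real.exp (θ * t) * u (Real.exp t)) ^ p =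
        Real.exp (θ * t) * Real.exp t ^ 2 * u (Real.exp t) ^ p := by
      rw [Real.mul_rpow (Real.exp_pos _).le hup.le, ← Real.exp_mul, ← Real.exp_nat_mul,
        ← Real.exp_add, ← mul_assoc, ← Real.exp_add]
      congr 2
      push_cast
      linear_combination t * hs.scaling
    have hterm : emdenFowlerTerm θ σ p q t (Real.exp (θ * t) * u (Real.exp t)) =
        Real.exp (θ * t) * Real.exp t ^ 2 *
          (σ * u (Real.exp t) ^ p + u (Real.exp t) ^ q) := by
      unfold emdenFowlerTerm
      rw [hq, mul_assoc σ, hp]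
      ring
    have heq' : Real.exp t ^ 2 * deriv (deriv u) (Real.exp t) +
        ((n : ℝ) - 1) * Real.exp t * deriv u (Real.exp t) +
        Real.exp t ^ 2 * (σ * u (Real.exp t) ^ p + u (Real.exp t) ^ q) = 0 := by
      have h1 : Real.exp t ^ 2 * (((n : ℝ) - 1) / Real.exp t) = ((n : ℝ) - 1) * Real.exp t := by
        field_simp
      linear_combination Real.exp t ^ 2 * heq - deriv u (Real.exp t) * h1
    rw [hterm]
    simp only [Function.comp_apply, Pi.add_apply, Pi.mul_apply]
    linear_combination Real.exp (θ * t) * heq'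
  · refine (h.singular.comp Real.tendsto_exp_atBot_nhdsGT).congr fun t => ?_
    rw [Function.comp_apply, ← mul_assoc, ← Real.exp_add]
    simp

/-- The inverse of the Emden-Fowler change of variables. -/
theorem IsEmdenFowlerSolution.isSingularSolution {T : ℝ} {v w : ℝ → ℝ}
    (hs : IsSupercritical θ ((n : ℝ) - 2 - θ) σ p q)
    (h : IsEmdenFowlerSolution θ ((n : ℝ) - 2 - θ) σ p q T v w) :
    IsSingularSolution n (fun x => σ * x ^ p + x ^ q) (Real.exp T)
      (fun r => r ^ (-θ) * v (Real.log r)) := by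
  have hlog : ∀ r ∈ Ioo 0 (Real.exp T), Real.log r < T := fun r hr =>
    (Real.log_lt_iff_lt_exp hr.1).2 hr.2
  set β := (n : ℝ) - 2 - θ with hβ
  set w' := fun t => θ * β * v t - (β - θ) * w t - emdenFowlerTerm θ σ p q t (v t) with hw'
  have h1 : ∀ r ∈ Ioo 0 (Real.exp T), HasDerivAt (fun r => r ^ (-θ) * v (Real.log r))
      (r ^ (-θ - 1) * (-θ * v (Real.log r) + w (Real.log r))) r := fun r hr =>
    hasDerivAt_rpow_mul_comp_log (-θ) hr.1 (h.hasDerivAt_fst _ (hlog r hr))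
  have h2 : ∀ r ∈ Ioo 0 (Real.exp T),
      HasDerivAt (fun r => r ^ (-θ - 1) * (-θ * v (Real.log r) + w (Real.log r)))
      (r ^ (-θ - 1 - 1) * ((-θ - 1) * (-θ * v (Real.log r) + w (Real.log r)) +
        (-θ * w (Real.log r) + w' (Real.log r)))) r := fun r hr =>
    hasDerivAt_rpow_mul_comp_log (g := fun t => -θ * v t + w t) (-θ - 1) hr.1
      (((h.hasDerivAt_fst _ (hlog r hr)).const_mul (-θ)).add (h.hasDerivAt_snd _ (hlog r hr)))
  have hd1 : ∀ r ∈ Ioo 0 (Real.exp T), deriv (fun r => r ^ (-θ) * v (Real.log r)) r =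
      r ^ (-θ - 1) * (-θ * v (Real.log r) + w (Real.log r)) := fun r hr => (h1 r hr).deriv
  refine ⟨Real.exp_pos T, fun r hr => mul_pos (Real.rpow_pos_of_pos hr.1 _) (h.pos _ (hlog r hr)),
    contDiffOn_two_of_hasDerivAt isOpen_Ioo h1 h2 ?_, fun r hr => ?_, ?_⟩
  · intro r hr
    have hvc := (h.hasDerivAt_fst _ (hlog r hr)).continuousAt
    have hwc := (h.hasDerivAt_snd _ (hlog r hr)).continuousAt
    have hv := h.pos _ (hlog r hr)
    have hvq := hvc.rpow_const (p := q) (Or.inl hv.ne')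
    have hvp := hvc.rpow_const (p := p) (Or.inl hv.ne')
    have hlc : ContinuousAt Real.log r := Real.continuousAt_log hr.1.ne'
    have hw'c : ContinuousAt w' (Real.log r) := by
      simp only [hw', emdenFowlerTerm]
      fun_prop
    have hvl : ContinuousAt (fun r => v (Real.log r)) r := hvc.comp hlc
    have hwl : ContinuousAt (fun r => w (Real.log r)) r := hwc.comp hlc
    have hw'l : ContinuousAt (fun r => w' (Real.log r)) r := hw'c.comp hlc
    have hrp := Real.continuousAt_rpow_const r (-θ - 1 - 1) (Or.inl hr.1.ne')
    refine ContinuousAt.continuousWithinAt ?_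
    fun_prop
  · have hd2 : deriv (deriv fun r => r ^ (-θ) * v (Real.log r)) r = _ :=
      ((h2 r hr).congr_of_eventuallyEq (by
        filter_upwards [isOpen_Ioo.mem_nhds hr] with x hx using hd1 x hx)).deriv
    rw [hd2, hd1 r hr]
    have hr0 := hr.1
    have hv := h.pos _ (hlog r hr)
    have hq : (r ^ (-θ) * v (Real.log r)) ^ q =
        r ^ (-θ - 1 - 1) * v (Real.log r) ^ q := by
      rw [Real.mul_rpow (by positivity) hv.le, ← Real.rpow_mul hr0.le]
      congr 2
      linear_combination -hs.scaling
    have hp : (r ^ (-θ) * v (Real.log r)) ^ p = r ^ (-θ - 1 - 1) *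
        (Real.exp (θ * (q - p) * Real.log r) * v (Real.log r) ^ p) := by
      rw [Real.mul_rpow (by positivity) hv.le, ← Real.rpow_mul hr0.le, ← mul_assoc,
        mul_comm (θ * (q - p)), ← Real.rpow_def_of_pos hr0, ← Real.rpow_add hr0]
      congr 2
      linear_combination -hs.scaling
    have hdiv : ((n : ℝ) - 1) / r * (r ^ (-θ - 1) * (-θ * v (Real.log r) + w (Real.log r))) =
        r ^ (-θ - 1 - 1) * (((n : ℝ) - 1) * (-θ * v (Real.log r) + w (Real.log r))) := by
      rw [Real.rpow_sub_one hr0.ne' (-θ - 1)]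
      field_simp
    rw [hq, hp, hdiv]
    simp only [hw', emdenFowlerTerm, hβ]
    ring
  · refine (h.singular.comp Real.tendsto_log_nhdsGT_zero).congr' ?_
    filter_upwards [self_mem_nhdsWithin] with r hr
    rw [Function.comp_apply, mul_comm (-θ), ← Real.rpow_def_of_pos hr]

theorem IsSingularSolution.eqOn {R₁ R₂ : ℝ} {u₁ u₂ : ℝ → ℝ}
    (hs : IsSupercritical θ ((n : ℝ) - 2 - θ) σ p q)
    (h₁ : IsSingularSolution n (fun x => σ * x ^ p + x ^ q) R₁ u₁)
    (h₂ : IsSingularSolution n (fun x => σ * x ^ p + x ^ q) R₂ u₂) :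
    EqOn u₁ u₂ (Ioo 0 (min R₁ R₂)) := by
  intro r hr
  have hR := lt_min h₁.radius_pos h₂.radius_pos
  have h := ((h₁.isEmdenFowlerSolution hs).mono
    (Real.log_le_log hR (min_le_left R₁ R₂))).unique hs
    ((h₂.isEmdenFowlerSolution hs).mono (Real.log_le_log hR (min_le_right R₁ R₂)))
    (Real.log_lt_log hr.1 hr.2)
  rw [Real.exp_log hr.1] at h
  exact mul_left_cancel₀ (Real.exp_pos _).ne' h

theorem IsSingularSolution.tendsto_div {R : ℝ} {u : ℝ → ℝ}
    (hs : IsSupercritical θ ((n : ℝ) - 2 - θ) σ p q)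
    (h : IsSingularSolution n (fun x => σ * x ^ p + x ^ q) R u) :
    Tendsto (fun r => u r / ((θ * ((n : ℝ) - 2 - θ)) ^ (1 / (q - 1)) * r ^ (-θ))) (𝓝[>] 0)
      (𝓝 1) := by
  have hB : 0 < θ * ((n : ℝ) - 2 - θ) :=
    mul_pos hs.theta_pos (hs.theta_pos.trans hs.theta_lt)
  have h1 := (((h.isEmdenFowlerSolution hs).mono (min_le_left _ 0)).tendsto_equilibrium hs
    (min_le_right _ _)).div_const ((θ * ((n : ℝ) - 2 - θ)) ^ (1 / (q - 1)))
  rw [div_self (by positivity)] at h1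
  refine (h1.comp Real.tendsto_log_nhdsGT_zero).congr' ?_
  filter_upwards [self_mem_nhdsWithin] with r hr
  have hr0 : 0 < r := hr
  rw [Function.comp_apply, Real.exp_log hr0, mul_comm θ, ← Real.rpow_def_of_pos hr0,
    Real.rpow_neg hr0.le]
  field_simp

/-- The constant solution of the Emden-Fowler equation. -/
theorem isEmdenFowlerSolution_const {β : ℝ} (hs : IsSupercritical θ β 0 p q) (T : ℝ) :
    IsEmdenFowlerSolution θ β 0 p q T (fun _ => (θ * β) ^ (1 / (q - 1))) (fun _ => 0) := by
  have hθ := hs.theta_pos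
  have hB : 0 < θ * β := mul_pos hθ (hθ.trans hs.theta_lt)
  have hq1 : 0 < q - 1 := by linarith [hs.one_lt, hs.lt]
  have hx0 : 0 < (θ * β) ^ (1 / (q - 1)) := by positivity
  refine ⟨fun t _ => hx0, fun t _ => hasDerivAt_const _ _, fun t _ => ?_, ?_⟩
  · refine (hasDerivAt_const _ _).congr_deriv ?_
    have hx0q : ((θ * β) ^ (1 / (q - 1))) ^ (q - 1) = θ * β := by
      rw [← Real.rpow_mul hB.le, one_div_mul_cancel hq1.ne', Real.rpow_one]
    rw [Real.rpow_sub_one hx0.ne', div_eq_iff hx0.ne'] at hx0q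
    unfold emdenFowlerTerm
    linear_combination hx0q
  · exact (Real.tendsto_exp_atTop.comp
      (tendsto_id.const_mul_atBot_of_neg (by linarith))).atTop_mul_const hx0

/-- θ < β means 4/(q-1) < n-2, that is, q > (n+2)/(n-2). -/
theorem isSupercritical_of_lt {σ : ℝ} (hn : 3 ≤ n) (hσ : 0 ≤ σ) (hp : 1 < p)
    (hpc : p < ((n : ℝ) + 2) / ((n : ℝ) - 2)) (hqc : ((n : ℝ) + 2) / ((n : ℝ) - 2) < q) :
    IsSupercritical (2 / (q - 1)) ((n : ℝ) - 2 - 2 / (q - 1)) σ p q := by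
  have hn' : (3 : ℝ) ≤ n := by exact_mod_cast hn
  have hq1 : 0 < q - 1 := by linarith
  refine ⟨by positivity, ?_, hσ, hp, by linarith, div_mul_cancel₀ _ hq1.ne'⟩
  rw [div_lt_iff₀ (by linarith)] at hqc
  have h1 : 2 / (q - 1) * 2 < (n : ℝ) - 2 := by
    rw [div_mul_eq_mul_div, div_lt_iff₀ hq1]
    linarith
  linarith

theorem laneEmdenSingular_eq {q : ℝ} (hq : q - 1 ≠ 0) (r : ℝ) :
    laneEmdenSingular n q r =
      (2 / (q - 1) * ((n : ℝ) - 2 - 2 / (q - 1))) ^ (1 / (q - 1)) * r ^ (-(2 / (q - 1))) := by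
  unfold laneEmdenSingular laneEmdenB
  rw [neg_div]
  congr 2
  field_simp
  ring

end EmdenFowlerTransform

/-! ### The main theorem. -/

theorem mainTheorem5 (n : ℕ) (hn : 3 ≤ n) (p q : ℝ) (hp : 1 < p)
    (hpc : p < ((n : ℝ) + 2) / ((n : ℝ) - 2)) (hqc : ((n : ℝ) + 2) / ((n : ℝ) - 2) < q) :
    -- the two-power equation has a singular solution near `0`, and only one
    (∃ (R : ℝ) (W : ℝ → ℝ), IsSingularSolution n (fun u => u ^ p + u ^ q) R W) ∧
    (∀ (R₁ R₂ : ℝ) (W₁ W₂ : ℝ → ℝ),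
      IsSingularSolution n (fun u => u ^ p + u ^ q) R₁ W₁ →
      IsSingularSolution n (fun u => u ^ p + u ^ q) R₂ W₂ →
      EqOn W₁ W₂ (Ioo 0 (min R₁ R₂))) ∧
    -- `w₀` is the singular solution of the pure power equation
    (∀ R : ℝ, 0 < R → IsSingularSolution n (fun u => u ^ q) R (laneEmdenSingular n q)) ∧
    (∀ (R : ℝ) (w : ℝ → ℝ), IsSingularSolution n (fun u => u ^ q) R w →
      EqOn w (laneEmdenSingular n q) (Ioo 0 R)) ∧
    -- the two are asymptotic at `0`
    (∀ (R : ℝ) (W₀ : ℝ → ℝ), IsSingularSolution n (fun u => u ^ p + u ^ q) R W₀ →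
      Tendsto (fun r => W₀ r / laneEmdenSingular n q r) (𝓝[>] 0) (𝓝 1)) := by
  have hq1 : q - 1 ≠ 0 := by linarith
  have hs₁ := isSupercritical_of_lt hn zero_le_one hp hpc hqc
  have hs₀ := isSupercritical_of_lt hn le_rfl hp hpc hqc
  -- The cases σ = 1 and σ = 0 put both equations into the common family.
  have hf₁ : (fun u : ℝ => u ^ p + u ^ q) = fun u => 1 * u ^ p + u ^ q := by simp
  have hf₀ : (fun u : ℝ => u ^ q) = fun u => 0 * u ^ p + u ^ q := by simp
  have hw₀ : ∀ R : ℝ, 0 < R →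
      IsSingularSolution n (fun u => 0 * u ^ p + u ^ q) R (laneEmdenSingular n q) := by
    intro R hR
    have h := (isEmdenFowlerSolution_const hs₀ (Real.log R)).isSingularSolution hs₀
    rw [Real.exp_log hR] at h
    have heq : laneEmdenSingular n q = fun r => r ^ (-(2 / (q - 1))) *
        (2 / (q - 1) * ((n : ℝ) - 2 - 2 / (q - 1))) ^ (1 / (q - 1)) := funext fun r => by
      rw [laneEmdenSingular_eq hq1, mul_comm]
    rwa [heq]
  rw [hf₁, hf₀]
  refine ⟨?_, fun R₁ R₂ W₁ W₂ h₁ h₂ => h₁.eqOn hs₁ h₂, hw₀, fun R w h => ?_, fun R W₀ h => ?_⟩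
  · obtain ⟨T, v, w, h⟩ := exists_isEmdenFowlerSolution hs₁
    exact ⟨_, _, h.isSingularSolution hs₁⟩
  · simpa using h.eqOn hs₀ (hw₀ R h.radius_pos)
  · rw [funext (laneEmdenSingular_eq hq1)]
    exact h.tendsto_div hs₁
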